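/- Let $0<\lambda\le\Lambda$ and $0<\alpha_0<1$. There exist constants $0<\beta\le 1$ and $C>0$, depending only on $\lambda,\Lambda,\alpha_0$, such that the following holds for every $\alpha\in[\alpha_0,1)$ (so the constants stay uniform as $\alpha\to1$). Let $\{\mathcal K^{kl}\}$ be any nonempty two-parameter family of kernels, measurable in $s$, with $$\frac{\alpha}{\Gamma(1-\alpha)}\,\frac{\lambda}{(t-s)^{1+\alpha}}\;\le\;\mathcal K^{kl}(t,s)\;\le\;\frac{\alpha}{\Gamma(1-\alpha)}\,\frac{\Lambda}{(t-s)^{1+\alpha}}\qquad(s<t),$$ let $f$ be continuous on $[-1,0]$, and let $u$ be a bounded measurable function on $(-\infty,0]$ which is a viscosity solution on $(-1,0]$ of $$\sup_k\inf_l\int_{-\infty}^t [u(t)-u(s)]\,\mathcal K^{kl}(t,s)\,ds=f(t).$$ Then $u\in C^{0,\beta}([-1/2,0])$ and $$\|u\|_{C^{0,\beta}([-1/2,0])}\le C\left(\|u\|_{L^\infty((-\infty,-1))}+\|f\|_{L^\infty([-1,0])}\right),$$ where the norm on the left is $\sup|u|$ plus the $\beta$-Hölder seminorm. Here $u$ is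 a viscosity subsolution on $(-1,0]$ if it is upper semicontinuous there and, whenever $t_0\in(-1,0]$, $r>0$, $\varphi\in C^1([t_0-r,t_0])$, $\varphi\ge u$ on $[t_0-r,t_0]$ and $\varphi(t_0)=u(t_0)$, the function $v$ equal to $\varphi$ on $[t_0-r,t_0]$ and to $u$ elsewhere satisfies $\sup_k\inf_l\int_{-\infty}^{t_0}[v(t_0)-v(s)]\mathcal K^{kl}(t_0,s)\,ds\le f(t_0)$. Supersolutions are defined symmetrically (lower semicontinuous, $\varphi\le u$, reversed inequality), and a solution is both. -/

import Mathlib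

open MeasureTheory Set
open scoped NNReal ENNReal

/-- Two-sided comparability of a kernel `K(t,s)`, `s < t`, with the kernel
`α / Γ(1-α) * (t-s)^(-1-α)` of the Marchaud derivative of order `α`. -/
structure IsMarchaudKernel (lam Lam α : ℝ) (K : ℝ → ℝ → ℝ) : Prop where
  aemeasurable : ∀ t, AEMeasurable (K t) (volume.restrict (Iio t))
  lower : ∀ t s, s < t →
    α / Real.Gamma (1 - α) * (lam / (t - s) ^ (1 + α)) ≤ K t s
  upper : ∀ t s, s < t →
    K t s ≤ α / Real.Gamma (1 - α) * (Lam / (t - s) ^ (1 + α))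

/-- The generalized Marchaud derivative `∫_{-∞}^t [v(t) - v(s)] K(t,s) ds`. -/
noncomputable def marchaud (K : ℝ → ℝ → ℝ) (v : ℝ → ℝ) (t : ℝ) : ℝ :=
  ∫ s in Iio t, (v t - v s) * K t s

/-- The nonlinear operator `sup_k inf_l ∫_{-∞}^t [v(t) - v(s)] K^{kl}(t,s) ds`. -/
noncomputable def supInfMarchaud {ι κ : Type*} (K : ι → κ → ℝ → ℝ → ℝ)
    (v : ℝ → ℝ) (t : ℝ) : ℝ :=
  ⨆ k, ⨅ l, marchaud (K k l) v t

/-- The function equal to `φ` on `[t₀ - r, t₀]` and to `u` elsewhere. -/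
noncomputable def splice (φ u : ℝ → ℝ) (t₀ r : ℝ) (s : ℝ) : ℝ :=
  if t₀ - r ≤ s ∧ s ≤ t₀ then φ s else u s

/-- `u` is a viscosity subsolution of `F u = f` on `I`: whenever a `C¹` function touches `u` from
above at `t₀ ∈ I` on a past interval `[t₀ - r, t₀]`, the spliced function satisfies
`F v (t₀) ≤ f(t₀)`. -/
def IsViscositySubsolution (F : (ℝ → ℝ) → ℝ → ℝ) (f u : ℝ → ℝ) (I : Set ℝ) : Prop :=
  UpperSemicontinuousOn u I ∧
  ∀ t₀ ∈ I, ∀ r > 0, ∀ φ : ℝ → ℝ, ContDiffOn ℝ 1 φ (Icc (t₀ - r) t₀) →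
    (∀ s ∈ Icc (t₀ - r) t₀, u s ≤ φ s) → φ t₀ = u t₀ →
    F (splice φ u t₀ r) t₀ ≤ f t₀

/-- Viscosity supersolutions: the same with `C¹` functions touching from below. -/
def IsViscositySupersolution (F : (ℝ → ℝ) → ℝ → ℝ) (f u : ℝ → ℝ) (I : Set ℝ) : Prop :=
  LowerSemicontinuousOn u I ∧
  ∀ t₀ ∈ I, ∀ r > 0, ∀ φ : ℝ → ℝ, ContDiffOn ℝ 1 φ (Icc (t₀ - r) t₀) →
    (∀ s ∈ Icc (t₀ - r) t₀, φ s ≤ u s) → φ t₀ = u t₀ →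
    f t₀ ≤ F (splice φ u t₀ r) t₀

def IsViscositySolution (F : (ℝ → ℝ) → ℝ → ℝ) (f u : ℝ → ℝ) (I : Set ℝ) : Prop :=
  IsViscositySubsolution F f u I ∧ IsViscositySupersolution F f u I

/-- The full norm `‖u‖_{C^{0,β}(S)} = sup_S |u| + [u]_{β,S}`, with values in `[0,∞]`. -/
noncomputable def holderNormOn (β : ℝ≥0) (u : ℝ → ℝ) (S : Set ℝ) : ℝ≥0∞ :=
  (⨆ t ∈ S, ‖u t‖ₑ) + eHolderNorm β (S.domRestrict u)

/-! Only the two-sided kernel bounds matter. They turn the viscosity inequalities into one extremal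
inequality, `IsExtremalSub`, satisfied by both `u` and `-u`. Its right side `F / (α * (1 - α))` uses
`Γ(1 - α) ≤ 1 / (1 - α)`; keeping track of this factor makes all constants uniform as `α → 1`.

Sup bound (`le_of_ae_le`): `u` is compared on `(-1, 0]` with an affine function that jumps at `-1`,
plus a small multiple of `-log (t + 1)`. The logarithm keeps the maximum of the difference away from
`-1`.

Hölder bound (`sub_le_modulus`, `not_doubling_max`): the variables are doubled. Suppose `w t - w s -
N |t - s| ^ β` minus a quadratic penalty has a positive maximum at `(T, S)`, with `S < T` after
possibly changing the sign of `w`, and let `d = T - S`. The operator only looks at the past, so each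
inequality is used at a single point, and one of two mechanisms gives a contradiction.

If `1 - α` is small, then looking back from `T` the modulus `N |d - h| ^ β` decreases on `0 < h <
d`. This yields a gain of order `N β / (1 - α)`, against a far loss of order `N β`
(`balance_of_concave`).

If `1 - α ≥ κ`, then on half of an interval preceding `S` the function is either below or above the
mean of `w S` and `w T`. Hence `T` or `S` sees a drop of at least `N d ^ β / 2` on a set of measure
comparable to `d`. This gain of order `N` beats losses of order `N β` once `β` is small
(`balance_of_density`). -/

/-! ### Power integrals against the kernel -/

theorem integral_Ioc_mul_rpow {α a : ℝ} (hα : α < 1) (ha : 0 < a) :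
    IntegrableOn (fun h : ℝ => h * h ^ (-1 - α)) (Ioc 0 a) ∧
      ∫ h in Ioc 0 a, h * h ^ (-1 - α) = a ^ (1 - α) / (1 - α) := by
  have e : EqOn (fun h : ℝ => h ^ (-α)) (fun h : ℝ => h * h ^ (-1 - α)) (Ioc 0 a) := by
    intro h hh
    have : (-α) = 1 + (-1 - α) := by ring
    simp only
    rw [this, Real.rpow_add hh.1, Real.rpow_one]
  have h1 := (intervalIntegrable_iff_integrableOn_Ioc_of_le ha.le).1
    (intervalIntegral.intervalIntegrable_rpow' (a := 0) (b := a) (r := -α) (by linarith))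
  refine ⟨h1.congr_fun e measurableSet_Ioc, ?_⟩
  rw [← setIntegral_congr_fun measurableSet_Ioc e, ← intervalIntegral.integral_of_le ha.le,
    integral_rpow (Or.inl (by linarith)), show -α + 1 = 1 - α by ring,
    Real.zero_rpow (by linarith), sub_zero]

theorem integral_Ioi_rpow_mul_rpow {α γ a : ℝ} (hγ : γ < α) (ha : 0 < a) :
    IntegrableOn (fun h : ℝ => h ^ γ * h ^ (-1 - α)) (Ioi a) ∧
      ∫ h in Ioi a, h ^ γ * h ^ (-1 - α) = a ^ (γ - α) / (α - γ) := by
  have e : EqOn (fun h : ℝ => h ^ (γ - α - 1)) (fun h : ℝ => h ^ γ * h ^ (-1 - α)) (Ioi a) := by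
    intro h hh
    have : γ - α - 1 = γ + (-1 - α) := by ring
    simp only
    rw [this, Real.rpow_add (ha.trans hh)]
  refine ⟨(integrableOn_Ioi_rpow_of_lt (by linarith) ha).congr_fun e measurableSet_Ioi, ?_⟩
  rw [← setIntegral_congr_fun measurableSet_Ioi e, integral_Ioi_rpow_of_lt (by linarith) ha,
    show γ - α - 1 + 1 = -(α - γ) by ring, neg_div_neg_eq, show -(α - γ) = γ - α by ring]

theorem integral_Ioi_rpow_kernel {α a : ℝ} (hα : 0 < α) (ha : 0 < a) :
    IntegrableOn (fun h : ℝ => h ^ (-1 - α)) (Ioi a) ∧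
      ∫ h in Ioi a, h ^ (-1 - α) = a ^ (-α) / α := by
  have := integral_Ioi_rpow_mul_rpow (γ := 0) hα ha
  simpa using this

/-! ### Extremal values and bounds for a single kernel -/

/-- The pointwise extremal value of `x K` over `lam ≤ K ≤ Lam`. -/
noncomputable def pucci (lam Lam x : ℝ) : ℝ := min (lam * x) (Lam * x)

theorem pucci_mono {lam Lam x y : ℝ} (hlam : 0 ≤ lam) (hLam : lam ≤ Lam) (h : x ≤ y) :
    pucci lam Lam x ≤ pucci lam Lam y :=
  min_le_min (mul_le_mul_of_nonneg_left h hlam) (mul_le_mul_of_nonneg_left h (hlam.trans hLam))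

theorem sub_le_pucci {lam Lam p q : ℝ} (hLam : lam ≤ Lam) (hp : 0 ≤ p) (hq : 0 ≤ q) :
    lam * p - Lam * q ≤ pucci lam Lam (p - q) := by
  refine le_min ?_ ?_ <;> nlinarith

theorem pucci_mul_le {lam Lam x k c : ℝ} (hc : 0 ≤ c) (h1 : c * lam ≤ k) (h2 : k ≤ c * Lam) :
    c * pucci lam Lam x ≤ x * k := by
  unfold pucci
  rcases le_total 0 x with hx | hx
  · nlinarith [min_le_left (lam * x) (Lam * x), mul_le_mul_of_nonneg_left h1 hx,
      mul_le_mul_of_nonneg_left (min_le_left (lam * x) (Lam * x)) hc]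
  · nlinarith [mul_le_mul_of_nonpos_left h2 hx,
      mul_le_mul_of_nonneg_left (min_le_right (lam * x) (Lam * x)) hc]

theorem setIntegral_Iio_eq_Ioi (F : ℝ → ℝ) (t : ℝ) :
    ∫ s in Iio t, F s = ∫ h in Ioi 0, F (t - h) := by
  have hp : (fun h : ℝ => t - h) ⁻¹' (Iio t) = Ioi 0 := by ext; simp
  rw [← hp]
  exact ((Measure.measurePreserving_sub_left volume t).setIntegral_preimage_emb
    (MeasurableEquiv.subLeft t).measurableEmbedding F (Iio t)).symm

theorem quasiMeasurePreserving_sub_left_Ioi (t : ℝ) :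
    Measure.QuasiMeasurePreserving (fun h : ℝ => t - h) (volume.restrict (Ioi 0))
      (volume.restrict (Iio t)) := by
  have hp : (fun h : ℝ => t - h) ⁻¹' (Iio t) = Ioi 0 := by ext; simp
  rw [← hp]
  exact ((Measure.measurePreserving_sub_left volume t).restrict_preimage
    measurableSet_Iio).quasiMeasurePreserving

namespace IsMarchaudKernel

variable {lam Lam α : ℝ} {K : ℝ → ℝ → ℝ}

theorem coeff_pos (hα : 0 < α) (hα1 : α < 1) : 0 < α / Real.Gamma (1 - α) :=
  div_pos hα (Real.Gamma_pos_of_pos (by linarith))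

theorem bounds (hK : IsMarchaudKernel lam Lam α K) (t : ℝ) {h : ℝ} (hh : 0 < h) :
    α / Real.Gamma (1 - α) * h ^ (-1 - α) * lam ≤ K t (t - h) ∧
      K t (t - h) ≤ α / Real.Gamma (1 - α) * h ^ (-1 - α) * Lam := by
  have h1 := hK.lower t (t - h) (by linarith)
  have h2 := hK.upper t (t - h) (by linarith)
  have e : h ^ (-1 - α) = (h ^ (1 + α))⁻¹ := by
    rw [← Real.rpow_neg hh.le]; ring_nf
  rw [sub_sub_cancel] at h1 h2
  rw [e]
  constructor
  · convert h1 using 1; ring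
  · convert h2 using 1; ring

/-- The Lipschitz bound at `t` reduces the singularity to `h ^ (-α)`, integrable near zero because
`α < 1`; boundedness handles the tail because `α > 0`. -/
theorem integrableOn_marchaud (hK : IsMarchaudKernel lam Lam α K) (hlam : 0 < lam)
    (hα : 0 < α) (hα1 : α < 1) {v : ℝ → ℝ} {t : ℝ}
    (hv : AEMeasurable v (volume.restrict (Iio t))) {L r B : ℝ} (hr : 0 < r)
    (hL : ∀ h ∈ Ioc 0 r, |v t - v (t - h)| ≤ L * h) (hB : ∀ h ∈ Ioi r, |v t - v (t - h)| ≤ B) :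
    IntegrableOn (fun h => (v t - v (t - h)) * K t (t - h)) (Ioi 0) ∧
      ∫ h in Ioi 0, (v t - v (t - h)) * K t (t - h) ≤
        α / Real.Gamma (1 - α) * Lam * (L * (r ^ (1 - α) / (1 - α)) + B * (r ^ (-α) / α)) := by
  have hc := coeff_pos hα hα1
  set c := α / Real.Gamma (1 - α)
  have hmeas : AEMeasurable (fun h => (v t - v (t - h)) * K t (t - h))
      (volume.restrict (Ioi 0)) :=
    ((hv.comp_quasiMeasurePreserving (quasiMeasurePreserving_sub_left_Ioi t)).const_sub _).mul
      ((hK.aemeasurable t).comp_quasiMeasurePreserving (quasiMeasurePreserving_sub_left_Ioi t))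
  have hbd : ∀ h : ℝ, 0 < h → ∀ D, |v t - v (t - h)| ≤ D →
      |(v t - v (t - h)) * K t (t - h)| ≤ c * Lam * D * h ^ (-1 - α) := by
    intro h hh D hD
    obtain ⟨h1, h2⟩ := hK.bounds t hh
    have hq : 0 < h ^ (-1 - α) := Real.rpow_pos_of_pos hh _
    have hk : 0 ≤ K t (t - h) := le_trans (by positivity) h1
    rw [abs_mul, abs_of_nonneg hk]
    calc _ ≤ D * (c * h ^ (-1 - α) * Lam) :=
          mul_le_mul hD h2 hk ((abs_nonneg _).trans hD)
      _ = _ := by ring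
  obtain ⟨i1, e1⟩ := integral_Ioc_mul_rpow hα1 hr
  obtain ⟨i2, e2⟩ := integral_Ioi_rpow_kernel hα hr
  have hnear : ∀ h ∈ Ioc 0 r,
      |(v t - v (t - h)) * K t (t - h)| ≤ c * Lam * L * (h * h ^ (-1 - α)) := by
    intro h hh
    have := hbd h hh.1 _ (hL h hh)
    rwa [← mul_assoc, mul_assoc (c * Lam) L h]
  have hfar : ∀ h ∈ Ioi r,
      |(v t - v (t - h)) * K t (t - h)| ≤ c * Lam * B * (h ^ (-1 - α)) :=
    fun h hh => hbd h (hr.trans hh) _ (hB h hh)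
  have hu : Ioc 0 r ∪ Ioi r = Ioi 0 := Ioc_union_Ioi_eq_Ioi hr.le
  have j1 : IntegrableOn (fun h => (v t - v (t - h)) * K t (t - h)) (Ioc 0 r) := by
    refine Integrable.mono' (i1.const_mul (c * Lam * L))
      (hmeas.mono_measure (Measure.restrict_mono Ioc_subset_Ioi_self le_rfl)).aestronglyMeasurable
      ((ae_restrict_iff' measurableSet_Ioc).2 (ae_of_all _ fun h hh => hnear h hh))
  have j2 : IntegrableOn (fun h => (v t - v (t - h)) * K t (t - h)) (Ioi r) := by
    refine Integrable.mono' (i2.const_mul (c * Lam * B))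
      (hmeas.mono_measure
        (Measure.restrict_mono (Ioi_subset_Ioi hr.le) le_rfl)).aestronglyMeasurable
      ((ae_restrict_iff' measurableSet_Ioi).2 (ae_of_all _ fun h hh => hfar h hh))
  refine ⟨hu ▸ j1.union j2, ?_⟩
  rw [← hu, setIntegral_union (Ioc_disjoint_Ioi le_rfl) measurableSet_Ioi j1 j2]
  have k1 := setIntegral_mono_on j1 (i1.const_mul (c * Lam * L)) measurableSet_Ioc
    fun h hh => (le_abs_self _).trans (hnear h hh)
  have k2 := setIntegral_mono_on j2 (i2.const_mul (c * Lam * B)) measurableSet_Ioi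
    fun h hh => (le_abs_self _).trans (hfar h hh)
  rw [integral_const_mul, e1] at k1
  rw [integral_const_mul, e2] at k2
  calc _ ≤ _ := add_le_add k1 k2
    _ = _ := by ring

theorem marchaud_eq (K : ℝ → ℝ → ℝ) (v : ℝ → ℝ) (t : ℝ) :
    marchaud K v t = ∫ h in Ioi 0, (v t - v (t - h)) * K t (t - h) :=
  setIntegral_Iio_eq_Ioi (fun s => (v t - v s) * K t s) t

theorem le_marchaud (hK : IsMarchaudKernel lam Lam α K)
    (hα : 0 < α) (hα1 : α < 1) {v : ℝ → ℝ} {t : ℝ}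
    (hi : IntegrableOn (fun h => (v t - v (t - h)) * K t (t - h)) (Ioi 0)) {g : ℝ → ℝ}
    (hg : IntegrableOn (fun h => g h * h ^ (-1 - α)) (Ioi 0))
    (hle : ∀ᵐ h ∂volume.restrict (Ioi 0), g h ≤ pucci lam Lam (v t - v (t - h))) :
    α / Real.Gamma (1 - α) * ∫ h in Ioi 0, g h * h ^ (-1 - α) ≤ marchaud K v t := by
  have hc := coeff_pos hα hα1
  rw [marchaud_eq, ← integral_const_mul]
  refine integral_mono_ae (hg.const_mul _) hi ?_
  filter_upwards [hle, ae_restrict_mem measurableSet_Ioi] with h h1 h2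
  obtain ⟨b1, b2⟩ := hK.bounds t h2
  have hq : 0 < h ^ (-1 - α) := Real.rpow_pos_of_pos h2 _
  refine le_trans ?_ (pucci_mul_le (mul_pos hc hq).le b1 b2)
  have := mul_le_mul_of_nonneg_left h1 (mul_pos hc hq).le
  calc _ = α / Real.Gamma (1 - α) * h ^ (-1 - α) * g h := by ring
    _ ≤ _ := this

end IsMarchaudKernel

theorem marchaud_neg (K : ℝ → ℝ → ℝ) (v : ℝ → ℝ) (t : ℝ) :
    marchaud K (fun s => -v s) t = -marchaud K v t := by
  unfold marchaud
  rw [← integral_neg]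
  congr 1; ext s; ring

/-! ### From viscosity solutions to the extremal inequality -/

/-- Convexity of `Γ` between `Γ(1) = Γ(2) = 1` gives `(1 - α) Γ(1 - α) = Γ(2 - α) ≤ 1`. -/
theorem Real.Gamma_one_sub_le {α : ℝ} (hα : 0 < α) (hα1 : α < 1) :
    Real.Gamma (1 - α) ≤ 1 / (1 - α) := by
  have h := Real.Gamma_add_one (s := 1 - α) (by linarith)
  have hc := Real.convexOn_Gamma.2 (show (1 : ℝ) ∈ Ioi 0 by simp) (show (2 : ℝ) ∈ Ioi 0 by simp)
    hα.le (show 0 ≤ 1 - α by linarith) (by ring)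
  simp only [smul_eq_mul, Real.Gamma_one, Real.Gamma_two] at hc
  rw [show α * 1 + (1 - α) * 2 = 1 - α + 1 by ring, h] at hc
  rw [le_div_iff₀ (by linarith)]
  linarith

theorem le_div_of_coeff_mul_le {α F I : ℝ} (hα : 0 < α) (hα1 : α < 1) (hF : 0 ≤ F)
    (h : α / Real.Gamma (1 - α) * I ≤ F) : I ≤ F / (α * (1 - α)) := by
  have hG := Real.Gamma_pos_of_pos (s := 1 - α) (by linarith)
  have hG1 := Real.Gamma_one_sub_le hα hα1
  have h1 : 0 < 1 - α := by linarith
  have : I ≤ F * Real.Gamma (1 - α) / α := by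
    rw [le_div_iff₀ hα]
    have : α / Real.Gamma (1 - α) * I = I * α / Real.Gamma (1 - α) := by ring
    rw [this, div_le_iff₀ hG] at h
    exact h
  refine this.trans ?_
  calc F * Real.Gamma (1 - α) / α ≤ F * (1 / (1 - α)) / α := by gcongr
    _ = F / (α * (1 - α)) := by field_simp

/-- Viscosity subsolutions of the extremal inequality `inf_K ∫ (w(t) - w(s)) K(t,s) ds ≤ F` on
`(-1, 0]`, tested with backward profiles `θ` touching `w` from above at `z` and with integrable
minorants `g` of the extremal integrand. -/
structure IsExtremalSub (lam Lam α F : ℝ) (w : ℝ → ℝ) : Prop where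
  usc : UpperSemicontinuousOn w (Ioc (-1) 0)
  test : ∀ z ∈ Ioc (-1 : ℝ) 0, ∀ r > 0, ∀ θ g : ℝ → ℝ, ContDiffOn ℝ 1 θ (Icc 0 r) → θ 0 = 0 →
    (∀ h ∈ Icc 0 r, w (z - h) ≤ w z + θ h) →
    IntegrableOn (fun h => g h * h ^ (-1 - α)) (Ioi 0) →
    (∀ᵐ h ∂volume.restrict (Ioi 0), (h ≤ r → g h ≤ pucci lam Lam (-θ h)) ∧
      (r < h → g h ≤ pucci lam Lam (w z - w (z - h)))) →
    ∫ h in Ioi 0, g h * h ^ (-1 - α) ≤ F / (α * (1 - α))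

section splice

variable {w θ : ℝ → ℝ} {z r : ℝ}

theorem splice_self (hr : 0 < r) (hθ : θ 0 = 0) :
    splice (fun s => w z + θ (z - s)) w z r z = w z := by
  simp [splice, hr.le, hθ]

theorem splice_sub_of_le {h : ℝ} (hh : 0 < h) (hr : h ≤ r) :
    splice (fun s => w z + θ (z - s)) w z r (z - h) = w z + θ h := by
  have : z - r ≤ z - h ∧ z - h ≤ z := ⟨by linarith, by linarith⟩
  simp only [splice, if_pos this, sub_sub_cancel]

theorem splice_sub_of_lt {h : ℝ} (hr : r < h) :
    splice (fun s => w z + θ (z - s)) w z r (z - h) = w (z - h) := by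
  have : ¬ (z - r ≤ z - h ∧ z - h ≤ z) := fun hc => by linarith [hc.1]
  simp only [splice, if_neg this]

theorem aemeasurable_splice (hz : z ≤ 0) (hw : AEMeasurable w (volume.restrict (Iic 0)))
    (hr : 0 < r) (hθ : ContDiffOn ℝ 1 θ (Icc 0 r)) :
    AEMeasurable (splice (fun s => w z + θ (z - s)) w z r) (volume.restrict (Iio z)) := by
  have hsub : Iio z ⊆ Icc (z - r) z ∪ Iio (z - r) := by
    intro s hs
    rcases lt_or_ge s (z - r) with h | h
    · exact Or.inr h
    · exact Or.inl ⟨h, le_of_lt hs⟩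
  refine AEMeasurable.mono_measure ?_ (Measure.restrict_mono hsub le_rfl)
  refine aemeasurable_union_iff.2 ⟨?_, ?_⟩
  · have hc : ContinuousOn (fun s => w z + θ (z - s)) (Icc (z - r) z) := by
      refine continuousOn_const.add (hθ.continuousOn.comp (by fun_prop) ?_)
      intro s hs
      exact ⟨by linarith [hs.2], by linarith [hs.1]⟩
    refine (hc.aemeasurable measurableSet_Icc).congr ?_
    filter_upwards [ae_restrict_mem measurableSet_Icc] with s hs
    rw [splice, if_pos ⟨hs.1, hs.2⟩]
  · have hsub : Iio (z - r) ⊆ Iic 0 := by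
      intro s hs
      have : s < z - r := hs
      show s ≤ 0
      linarith
    refine (hw.mono_measure (Measure.restrict_mono hsub le_rfl)).congr ?_
    filter_upwards [ae_restrict_mem measurableSet_Iio] with s hs
    have : s < z - r := hs
    rw [splice, if_neg fun hc => by linarith [hc.1]]

theorem splice_neg (φ : ℝ → ℝ) :
    splice (fun s => -φ s) (fun s => -w s) z r = fun s => -splice φ w z r s := by
  ext s
  simp only [splice]
  split_ifs <;> rfl

/-- The constant `C` is chosen before the kernel: a real `⨆` or `⨅` over an unbounded family is `0`,
so sup-inf estimates need bounds uniform over the family. -/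
theorem marchaud_splice_bounds {lam Lam α : ℝ} (hlam : 0 < lam) (hα : 0 < α) (hα1 : α < 1)
    (hz : z ≤ 0) (hw : AEMeasurable w (volume.restrict (Iic 0))) {B : ℝ}
    (hB : ∀ t ≤ 0, |w t| ≤ B) (hr : 0 < r) (hθ : ContDiffOn ℝ 1 θ (Icc 0 r)) (hθ0 : θ 0 = 0) :
    ∃ C : ℝ, ∀ K, IsMarchaudKernel lam Lam α K →
      |marchaud K (splice (fun s => w z + θ (z - s)) w z r) z| ≤ C ∧
      ∀ g : ℝ → ℝ, IntegrableOn (fun h => g h * h ^ (-1 - α)) (Ioi 0) →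
        (∀ᵐ h ∂volume.restrict (Ioi 0), (h ≤ r → g h ≤ pucci lam Lam (-θ h)) ∧
          (r < h → g h ≤ pucci lam Lam (w z - w (z - h)))) →
        α / Real.Gamma (1 - α) * ∫ h in Ioi 0, g h * h ^ (-1 - α) ≤
          marchaud K (splice (fun s => w z + θ (z - s)) w z r) z := by
  obtain ⟨L, hL⟩ := hθ.exists_lipschitzOnWith one_ne_zero (convex_Icc 0 r) isCompact_Icc
  have hm := aemeasurable_splice hz hw hr hθ
  have hself : splice (fun s => w z + θ (z - s)) w z r z = w z := splice_self hr hθ0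
  have hnear : ∀ h ∈ Ioc 0 r, splice (fun s => w z + θ (z - s)) w z r (z - h) = w z + θ h :=
    fun h hh => splice_sub_of_le hh.1 hh.2
  have hfar : ∀ h ∈ Ioi r, splice (fun s => w z + θ (z - s)) w z r (z - h) = w (z - h) :=
    fun h hh => splice_sub_of_lt hh
  generalize splice (fun s => w z + θ (z - s)) w z r = v at *
  have d1 : ∀ h ∈ Ioc 0 r, |v z - v (z - h)| ≤ L * h := by
    intro h hh
    rw [hself, hnear h hh]
    have := hL.dist_le_mul h ⟨hh.1.le, hh.2⟩ 0 ⟨le_rfl, hr.le⟩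
    rw [Real.dist_eq, Real.dist_eq, hθ0, sub_zero, sub_zero, abs_of_pos hh.1] at this
    rwa [show w z - (w z + θ h) = -θ h by ring, abs_neg]
  have d2 : ∀ h ∈ Ioi r, |v z - v (z - h)| ≤ 2 * B := by
    intro h hh
    rw [hself, hfar h hh]
    have h1 := hB z hz
    have h2 := hB (z - h) (by linarith [hr.trans hh])
    calc _ ≤ |w z| + |w (z - h)| := abs_sub _ _
      _ ≤ _ := by linarith
  refine ⟨α / Real.Gamma (1 - α) * Lam * (L * (r ^ (1 - α) / (1 - α)) + 2 * B * (r ^ (-α) / α)),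
    fun K hK => ?_⟩
  obtain ⟨i1, e1⟩ := hK.integrableOn_marchaud hlam hα hα1 hm hr d1 d2
  obtain ⟨-, e2⟩ := hK.integrableOn_marchaud (v := fun s => -v s) hlam hα hα1 hm.neg hr
    (fun h hh => by rw [neg_sub_neg, abs_sub_comm]; exact d1 h hh)
    (fun h hh => by rw [neg_sub_neg, abs_sub_comm]; exact d2 h hh)
  rw [← IsMarchaudKernel.marchaud_eq] at e1
  rw [← IsMarchaudKernel.marchaud_eq K (fun s => -v s), marchaud_neg] at e2
  refine ⟨abs_le.2 ⟨by linarith, e1⟩, fun g hg hle => ?_⟩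
  refine hK.le_marchaud hα hα1 i1 hg ?_
  filter_upwards [hle, ae_restrict_mem measurableSet_Ioi] with h h1 h2
  rcases le_or_gt h r with h3 | h3
  · rw [hself, hnear h ⟨h2, h3⟩]
    convert h1.1 h3 using 2; ring
  · rw [hself, hfar h h3]
    exact h1.2 h3

end splice

section viscosity

variable {lam Lam α F B : ℝ} {ι κ : Type*} [Nonempty ι] [Nonempty κ] {K : ι → κ → ℝ → ℝ → ℝ}
  {f u : ℝ → ℝ}

theorem contDiffOn_const_add_comp_sub {θ : ℝ → ℝ} {z r : ℝ} (c : ℝ)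
    (hθ : ContDiffOn ℝ 1 θ (Icc 0 r)) :
    ContDiffOn ℝ 1 (fun s => c + θ (z - s)) (Icc (z - r) z) := by
  refine contDiffOn_const.add (hθ.comp (contDiffOn_const.sub contDiffOn_id) ?_)
  intro s hs
  exact ⟨by simpa using hs.2, by linarith [hs.1]⟩

theorem IsViscositySubsolution.isExtremalSub (hlam : 0 < lam) (hα : 0 < α) (hα1 : α < 1)
    (hK : ∀ k l, IsMarchaudKernel lam Lam α (K k l))
    (hu : AEMeasurable u (volume.restrict (Iic 0))) (hB : ∀ t ≤ 0, |u t| ≤ B)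
    (hF : 0 ≤ F) (hf : ∀ t ∈ Ioc (-1 : ℝ) 0, f t ≤ F)
    (h : IsViscositySubsolution (supInfMarchaud K) f u (Ioc (-1) 0)) :
    IsExtremalSub lam Lam α F u := by
  refine ⟨h.1, fun z hz r hr θ g hθ hθ0 hle hg hgle => le_div_of_coeff_mul_le hα hα1 hF ?_⟩
  obtain ⟨C, hC⟩ := marchaud_splice_bounds (lam := lam) (Lam := Lam) hlam hα hα1 hz.2 hu hB hr
    hθ hθ0
  have h1 := h.2 z hz r hr (fun s => u z + θ (z - s)) (contDiffOn_const_add_comp_sub _ hθ)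
    (fun s hs => by
      have := hle (z - s) ⟨by linarith [hs.2], by linarith [hs.1]⟩
      rwa [sub_sub_cancel] at this) (by simp [hθ0])
  refine le_trans ?_ (h1.trans (hf z hz))
  -- The lower bound holds for every kernel, so one `k` with all `l` bounds the sup-inf from below.
  obtain ⟨k⟩ := ‹Nonempty ι›
  have hbb : ∀ k, BddBelow (range fun l =>
      marchaud (K k l) (splice (fun s => u z + θ (z - s)) u z r) z) := by
    rintro k
    refine ⟨-C, ?_⟩
    rintro _ ⟨l, rfl⟩
    exact (abs_le.1 (hC _ (hK k l)).1).1
  refine le_ciSup_of_le ?_ k (le_ciInf fun l => (hC _ (hK k l)).2 g hg hgle)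
  refine ⟨C, ?_⟩
  rintro _ ⟨k, rfl⟩
  obtain ⟨l⟩ := ‹Nonempty κ›
  exact (ciInf_le (hbb k) l).trans (abs_le.1 (hC _ (hK k l)).1).2

theorem IsViscositySupersolution.isExtremalSub_neg (hlam : 0 < lam) (hα : 0 < α) (hα1 : α < 1)
    (hK : ∀ k l, IsMarchaudKernel lam Lam α (K k l))
    (hu : AEMeasurable u (volume.restrict (Iic 0))) (hB : ∀ t ≤ 0, |u t| ≤ B)
    (hF : 0 ≤ F) (hf : ∀ t ∈ Ioc (-1 : ℝ) 0, -F ≤ f t)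
    (h : IsViscositySupersolution (supInfMarchaud K) f u (Ioc (-1) 0)) :
    IsExtremalSub lam Lam α F (fun t => -u t) := by
  have husc : UpperSemicontinuousOn (fun t => -u t) (Ioc (-1) 0) :=
    continuous_neg.comp_lowerSemicontinuousOn_antitone h.1 fun a b hab => neg_le_neg hab
  refine ⟨husc, fun z hz r hr θ g hθ hθ0 hle hg hgle => le_div_of_coeff_mul_le hα hα1 hF ?_⟩
  obtain ⟨C, hC⟩ := marchaud_splice_bounds (lam := lam) (Lam := Lam) (w := fun t => -u t) hlam
    hα hα1 hz.2 hu.neg (B := B) (fun t ht => by rw [abs_neg]; exact hB t ht) hr hθ hθ0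
  have h1 := h.2 z hz r hr (fun s => -(-u z + θ (z - s)))
    (contDiffOn_const_add_comp_sub _ hθ).neg
    (fun s hs => by
      have := hle (z - s) ⟨by linarith [hs.2], by linarith [hs.1]⟩
      rw [sub_sub_cancel] at this
      linarith) (by simp [hθ0])
  have hv : splice (fun s => -u z + θ (z - s)) (fun t => -u t) z r =
      fun s => -splice (fun s => -(-u z + θ (z - s))) u z r s := by
    rw [← splice_neg]; simp
  rw [hv] at hC
  simp only [marchaud_neg, abs_neg] at hC
  generalize splice (fun s => -(-u z + θ (z - s))) u z r = v at *
  suffices supInfMarchaud K v z ≤ -(α / Real.Gamma (1 - α) * ∫ h in Ioi 0, g h * h ^ (-1 - α)) by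
    linarith [hf z hz]
  -- An upper bound for the sup-inf needs every `k` but only one `l`.
  refine ciSup_le fun k => ?_
  obtain ⟨l⟩ := ‹Nonempty κ›
  refine ciInf_le_of_le ⟨-C, ?_⟩ l ?_
  · rintro _ ⟨l, rfl⟩
    exact (abs_le.1 (hC _ (hK k l)).1).1
  · linarith [(hC _ (hK k l)).2 g hg hgle]

end viscosity

/-! ### Integrals of piecewise minorants -/

/-- `g` has integral `I` on `(0, ∞)` against `h ^ (-1 - α)`. -/
def HasKernelIntegral (α : ℝ) (g : ℝ → ℝ) (I : ℝ) : Prop :=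
  IntegrableOn (fun h => g h * h ^ (-1 - α)) (Ioi 0) ∧ ∫ h in Ioi 0, g h * h ^ (-1 - α) = I

namespace HasKernelIntegral

variable {α I J : ℝ} {g k : ℝ → ℝ}

theorem add (hg : HasKernelIntegral α g I) (hk : HasKernelIntegral α k J) :
    HasKernelIntegral α (fun h => g h + k h) (I + J) := by
  have e : (fun h => (g h + k h) * h ^ (-1 - α)) =
      fun h => g h * h ^ (-1 - α) + k h * h ^ (-1 - α) := by ext h; ring
  unfold HasKernelIntegral
  rw [e]
  exact ⟨hg.1.add hk.1, by rw [integral_add hg.1 hk.1, hg.2, hk.2]⟩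

theorem const_mul (c : ℝ) (hg : HasKernelIntegral α g I) :
    HasKernelIntegral α (fun h => c * g h) (c * I) := by
  unfold HasKernelIntegral
  simp only [mul_assoc]
  exact ⟨hg.1.const_mul c, by rw [integral_const_mul, hg.2]⟩

theorem indicator_of {s : Set ℝ} (hs : MeasurableSet s) (h0 : s ⊆ Ioi 0)
    (hi : IntegrableOn (fun h => g h * h ^ (-1 - α)) s)
    (hI : ∫ h in s, g h * h ^ (-1 - α) = I) : HasKernelIntegral α (s.indicator g) I := by
  have e : (fun h => s.indicator g h * h ^ (-1 - α)) =
      s.indicator (fun h => g h * h ^ (-1 - α)) := by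
    ext h; rw [indicator_mul_left]
  unfold HasKernelIntegral
  rw [e]
  refine ⟨(hi.integrable_indicator hs).integrableOn, ?_⟩
  rw [setIntegral_indicator hs, inter_eq_self_of_subset_right h0, hI]

theorem near {a : ℝ} (hα : α < 1) (ha : 0 < a) :
    HasKernelIntegral α ((Ioc 0 a).indicator fun h => h) (a ^ (1 - α) / (1 - α)) :=
  indicator_of measurableSet_Ioc Ioc_subset_Ioi_self (integral_Ioc_mul_rpow hα ha).1
    (integral_Ioc_mul_rpow hα ha).2

theorem far_rpow {γ a : ℝ} (hγ : γ < α) (ha : 0 < a) :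
    HasKernelIntegral α ((Ioi a).indicator fun h => h ^ γ) (a ^ (γ - α) / (α - γ)) :=
  indicator_of measurableSet_Ioi (Ioi_subset_Ioi ha.le) (integral_Ioi_rpow_mul_rpow hγ ha).1
    (integral_Ioi_rpow_mul_rpow hγ ha).2

theorem far {a : ℝ} (hα : 0 < α) (ha : 0 < a) :
    HasKernelIntegral α ((Ioi a).indicator fun _ => 1) (a ^ (-α) / α) := by
  simpa using far_rpow hα ha

end HasKernelIntegral

/-! ### The logarithmic barrier and the sup bound -/

/-- The function `-log (1 - x)` on `(0, 1)`, extended by zero. -/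
noncomputable def logBarrier (x : ℝ) : ℝ := if x < 1 then -Real.log (1 - x) else 0

theorem logBarrier_nonneg {x : ℝ} (hx : 0 ≤ x) : 0 ≤ logBarrier x := by
  unfold logBarrier
  split_ifs with h
  · exact neg_nonneg.2 (Real.log_nonpos (by linarith) (by linarith))
  · exact le_rfl

theorem measurable_logBarrier : Measurable logBarrier :=
  Measurable.ite measurableSet_Iio (Real.measurable_log.comp (measurable_const.sub measurable_id)).neg
    measurable_const

/-- Near zero the barrier is at most `2 x`, and at `1` its singularity is logarithmic; both are
integrable against `x ^ (-1 - α)`. -/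
theorem integrableOn_logBarrier {α : ℝ} (hα : 0 < α) (hα1 : α < 1) :
    IntegrableOn (fun x => logBarrier x * x ^ (-1 - α)) (Ioi 0) := by
  have hm : Measurable (fun x => logBarrier x * x ^ (-1 - α)) :=
    measurable_logBarrier.mul (measurable_id.pow_const _)
  have h1 : IntegrableOn (fun x => logBarrier x * x ^ (-1 - α)) (Ioc 0 (1 / 2)) := by
    refine Integrable.mono' ((integral_Ioc_mul_rpow hα1 (a := 1 / 2) (by norm_num)).1.const_mul 2)
      hm.aestronglyMeasurable ?_
    filter_upwards [ae_restrict_mem measurableSet_Ioc] with x hx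
    have hq : 0 < x ^ (-1 - α) := Real.rpow_pos_of_pos hx.1 _
    rw [Real.norm_eq_abs, abs_of_nonneg (mul_nonneg (logBarrier_nonneg hx.1.le) hq.le), ← mul_assoc]
    refine mul_le_mul_of_nonneg_right ?_ hq.le
    have hx1 : 0 < 1 - x := by linarith [hx.2]
    rw [logBarrier, if_pos (by linarith)]
    have := Real.one_sub_inv_le_log_of_pos hx1
    have h3 : (1 - x)⁻¹ ≤ 1 + 2 * x := by
      rw [inv_le_comm₀ hx1 (by linarith [hx.1]), inv_le_iff_one_le_mul₀ (by linarith [hx.1])]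
      nlinarith [hx.1, hx.2]
    linarith
  have h2 : IntegrableOn (fun x => logBarrier x * x ^ (-1 - α)) (Ioc (1 / 2) 1) := by
    have hl : IntegrableOn (fun x : ℝ => Real.log (1 - x)) (Ioc (1 / 2) 1) := by
      refine (intervalIntegrable_iff_integrableOn_Ioc_of_le (by norm_num)).1 ?_
      have := (intervalIntegral.intervalIntegrable_log' (a := 1 / 2) (b := 0)).comp_sub_left 1
      norm_num at this
      exact this
    refine Integrable.mono' (hl.norm.const_mul ((1 / 2 : ℝ) ^ (-1 - α))) hm.aestronglyMeasurable ?_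
    filter_upwards [ae_restrict_mem measurableSet_Ioc] with x hx
    have hx0 : 0 < x := by linarith [hx.1]
    rw [norm_mul, mul_comm]
    refine mul_le_mul ?_ ?_ (norm_nonneg _) (by positivity)
    · rw [Real.norm_eq_abs, abs_of_pos (Real.rpow_pos_of_pos hx0 _)]
      exact Real.rpow_le_rpow_of_nonpos (by norm_num) hx.1.le (by linarith)
    · unfold logBarrier
      split_ifs
      · rw [norm_neg]
      · rw [norm_zero]; exact norm_nonneg _
  have h3 : IntegrableOn (fun x => logBarrier x * x ^ (-1 - α)) (Ioi 1) := by
    refine integrableOn_zero.congr_fun ?_ measurableSet_Ioi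
    intro x hx
    have : ¬ x < 1 := not_lt.2 (le_of_lt hx)
    simp [logBarrier, this]
  have := (h1.union h2).union h3
  rwa [Ioc_union_Ioc_eq_Ioc (by norm_num) (by norm_num), Ioc_union_Ioi_eq_Ioi zero_le_one] at this

theorem HasKernelIntegral.logBarrier_div {α τ : ℝ} (hα : 0 < α) (hα1 : α < 1) (hτ : 0 < τ) :
    HasKernelIntegral α (fun h => logBarrier (h / τ))
      (τ ^ (-α) * ∫ x in Ioi 0, logBarrier x * x ^ (-1 - α)) := by
  have e : EqOn (fun h : ℝ => τ ^ (-1 - α) * (logBarrier (τ⁻¹ * h) * (τ⁻¹ * h) ^ (-1 - α)))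
      (fun h => logBarrier (h / τ) * h ^ (-1 - α)) (Ioi 0) := by
    intro h hh
    have hh : 0 < h := hh
    simp only
    rw [Real.mul_rpow (by positivity) hh.le, Real.inv_rpow hτ.le, inv_mul_eq_div]
    have : τ ^ (-1 - α) ≠ 0 := (Real.rpow_pos_of_pos hτ _).ne'
    field_simp
  have i := integrableOn_logBarrier hα hα1
  have hτ' : 0 < τ⁻¹ := by positivity
  constructor
  · refine IntegrableOn.congr_fun (Integrable.const_mul ?_ _) e measurableSet_Ioi
    refine (integrableOn_Ioi_comp_mul_left_iff
      (fun x => logBarrier x * x ^ (-1 - α)) 0 hτ').2 ?_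
    rwa [mul_zero]
  · rw [← setIntegral_congr_fun measurableSet_Ioi e, integral_const_mul,
      integral_comp_mul_left_Ioi (fun x => logBarrier x * x ^ (-1 - α)) 0 hτ', mul_zero, inv_inv,
      smul_eq_mul, ← mul_assoc, ← Real.rpow_add_one hτ.ne']
    ring_nf

theorem ae_sub_left_of_ae_restrict_Iio {p : ℝ → Prop} {a : ℝ}
    (hp : ∀ᵐ t ∂volume.restrict (Iio a), p t) (z : ℝ) :
    ∀ᵐ h : ℝ, z - h < a → p (z - h) :=
  (Measure.measurePreserving_sub_left volume z).quasiMeasurePreserving.ae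
    ((ae_restrict_iff' measurableSet_Iio).1 hp)

/-- Weighted AM-GM, with weights for which the powers of `τ` cancel. It shows that an affine
function of slope `C` with a jump `C` at `-1` has a large enough derivative at every distance `τ`
from `-1`. -/
theorem one_le_weighted_rpow {α τ : ℝ} (hα : 0 < α) (hα1 : α < 1) (hτ : 0 < τ) :
    1 ≤ α * τ ^ (1 - α) + (1 - α) * τ ^ (-α) := by
  have h := Real.geom_mean_le_arith_mean2_weighted (w₁ := α) (w₂ := 1 - α)
    (p₁ := τ ^ (1 - α)) (p₂ := τ ^ (-α)) hα.le (by linarith)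
    (by positivity) (by positivity) (by ring)
  rw [← Real.rpow_mul hτ.le, ← Real.rpow_mul hτ.le, ← Real.rpow_add hτ,
    show (1 - α) * α + -α * (1 - α) = 0 by ring, Real.rpow_zero] at h
  exact h

theorem UpperSemicontinuousOn.sub_continuousOn {X : Type*} [TopologicalSpace X] {f g : X → ℝ}
    {s : Set X} (hf : UpperSemicontinuousOn f s) (hg : ContinuousOn g s) :
    UpperSemicontinuousOn (fun x => f x - g x) s := by
  have h := hf.add hg.neg.upperSemicontinuousOn
  simp only [sub_eq_add_neg]
  exact h

namespace IsExtremalSub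

variable {lam Lam α F : ℝ} {w : ℝ → ℝ}

theorem hasKernelIntegral_le (h : IsExtremalSub lam Lam α F w) {z r I : ℝ} {θ g : ℝ → ℝ}
    (hz : z ∈ Ioc (-1 : ℝ) 0) (hr : 0 < r) (hθ : ContDiffOn ℝ 1 θ (Icc 0 r)) (hθ0 : θ 0 = 0)
    (hle : ∀ h ∈ Icc 0 r, w (z - h) ≤ w z + θ h) (hg : HasKernelIntegral α g I)
    (hae : ∀ᵐ h : ℝ, 0 < h → (h ≤ r → g h ≤ pucci lam Lam (-θ h)) ∧
      (r < h → g h ≤ pucci lam Lam (w z - w (z - h)))) : I ≤ F / (α * (1 - α)) := by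
  rw [← hg.2]
  exact h.test z hz r hr θ g hθ hθ0 hle hg.1 ((ae_restrict_iff' measurableSet_Ioi).2 hae)

/-- Comparison with `W`, which tends to infinity at `-1`, so that a positive maximum of `w - W` is
attained inside. Tested there, `W` already uses up the whole right side, and the excess `m` seen
beyond `-1` breaks the inequality. -/
theorem le_barrier (h : IsExtremalSub lam Lam α F w) (hlam : 0 < lam) (hLam : lam ≤ Lam)
    (hα : 0 < α) (hα1 : α < 1) (hF : 0 ≤ F) {B X : ℝ} (hB : ∀ t ∈ Ioc (-1 : ℝ) 0, w t ≤ B)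
    (hX : ∀ᵐ t ∂volume.restrict (Iio (-1)), w t ≤ X) {ε : ℝ} (hε : 0 < ε)
    {t : ℝ} (ht : t ∈ Ioc (-1 : ℝ) 0) :
    w t ≤ X + F / lam * (2 + t) +
      ε * (Lam * (∫ x in Ioi 0, logBarrier x * x ^ (-1 - α)) * α / lam - Real.log (t + 1)) := by
  set κ := ∫ x in Ioi 0, logBarrier x * x ^ (-1 - α) with hκ
  have hκ0 : 0 ≤ κ := setIntegral_nonneg measurableSet_Ioi fun x hx =>
    mul_nonneg (logBarrier_nonneg (le_of_lt hx)) (Real.rpow_nonneg (le_of_lt hx) _)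
  have hLam0 : 0 < Lam := hlam.trans_le hLam
  -- With this value the extra jump `ε * κ'` at `-1` exactly pays for the worst-case contribution of
  -- the logarithm.
  set κ' := Lam * κ * α / lam with hκ'
  have hκ'0 : 0 ≤ κ' := by positivity
  set C := F / lam with hC
  have hC0 : 0 ≤ C := by positivity
  have hlamC : lam * C = F := by rw [hC]; field_simp
  set W : ℝ → ℝ := fun t => X + C * (2 + t) + ε * (κ' - Real.log (t + 1)) with hW
  by_contra! hcon
  change W t < w t at hcon
  -- On `(-1, -1 + η]` the logarithm alone lifts `W` above the bound `B` of `w`.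
  obtain ⟨η, hη0, hηt, hηB⟩ : ∃ η : ℝ, 0 < η ∧ η ≤ t + 1 ∧ Real.log η ≤ -(|B - X| / ε) := by
    refine ⟨min (t + 1) (Real.exp (-(|B - X| / ε))),
      lt_min (by linarith [ht.1]) (Real.exp_pos _), min_le_left _ _, ?_⟩
    rw [Real.log_le_iff_le_exp (lt_min (by linarith [ht.1]) (Real.exp_pos _))]
    exact min_le_right _ _
  have hsmall : ∀ s ∈ Ioc (-1 : ℝ) (-1 + η), w s ≤ W s := by
    intro s hs
    have h1 : Real.log (s + 1) ≤ -(|B - X| / ε) :=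
      (Real.log_le_log (by linarith [hs.1]) (by linarith [hs.2])).trans hηB
    have h2 : ε * (|B - X| / ε) ≤ ε * (κ' - Real.log (s + 1)) := by
      gcongr; linarith
    rw [mul_div_cancel₀ _ hε.ne'] at h2
    have h3 := hB s ⟨hs.1, by linarith [hs.2, ht.2]⟩
    have h4 := le_abs_self (B - X)
    have h5 : 0 ≤ C * (2 + s) := mul_nonneg hC0 (by linarith [hs.1])
    simp only [hW]
    linarith
  have hWc : ContinuousOn W (Icc (-1 + η) 0) := by
    have : ∀ s ∈ Icc (-1 + η) 0, s + 1 ≠ 0 := fun s hs => by linarith [hs.1]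
    fun_prop (disch := assumption)
  have hsub : Icc (-1 + η) 0 ⊆ Ioc (-1 : ℝ) 0 := fun s hs => ⟨by linarith [hs.1], hs.2⟩
  have htmem : t ∈ Icc (-1 + η) 0 := ⟨by linarith, ht.2⟩
  obtain ⟨z, hzI, hzmax⟩ := UpperSemicontinuousOn.exists_isMaxOn ⟨t, htmem⟩ isCompact_Icc
    ((h.usc.mono hsub).sub_continuousOn hWc)
  set m := w z - W z with hm
  have hm0 : 0 < m := by
    have : w t - W t ≤ w z - W z := hzmax htmem
    linarith
  have hmax : ∀ s ∈ Ioc (-1 : ℝ) 0, w s ≤ W s + m := by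
    intro s hs
    rcases le_or_gt s (-1 + η) with h1 | h1
    · linarith [hsmall s ⟨hs.1, h1⟩]
    · have : w s - W s ≤ w z - W z := hzmax (show s ∈ Icc (-1 + η) 0 from ⟨h1.le, hs.2⟩)
      linarith
  have hz := hsub hzI
  set τ := z + 1 with hτ
  have hτ0 : 0 < τ := by linarith [hz.1]
  have hτ1 : τ ≤ 1 := by linarith [hz.2]
  have hlogτ : Real.log τ ≤ 0 := Real.log_nonpos hτ0.le hτ1
  -- Testing stops at `τ / 2`, since `W (z - h)` is singular at `h = τ`; from there to `τ` the
  -- maximality of `m` takes over.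
  have hθ : ContDiffOn ℝ 1 (fun h => W (z - h) - W z) (Icc 0 (τ / 2)) := by
    have : ∀ h ∈ Icc 0 (τ / 2), z - h + 1 ≠ 0 := fun s hs => by linarith [hs.2]
    simp only [hW]
    fun_prop (disch := assumption)
  have hI := ((HasKernelIntegral.near hα1 hτ0).const_mul F).add
    (((HasKernelIntegral.logBarrier_div hα hα1 hτ0).const_mul (-(Lam * ε))).add
      ((HasKernelIntegral.far hα hτ0).const_mul (F + lam * (ε * κ' + m))))
  have hnear : ∀ x ∈ Ioo 0 τ, F * (Ioc 0 τ).indicator (fun h => h) x +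
      (-(Lam * ε) * logBarrier (x / τ) + (F + lam * (ε * κ' + m)) *
        (Ioi τ).indicator (fun _ => 1) x) ≤ pucci lam Lam (W z - W (z - x)) := by
    intro x hx
    rw [indicator_of_mem (show x ∈ Ioc 0 τ from ⟨hx.1, hx.2.le⟩),
      indicator_of_notMem (show x ∉ Ioi τ from not_lt.2 hx.2.le)]
    have h1 := sub_le_pucci hLam (mul_nonneg hC0 hx.1.le)
      (mul_nonneg hε.le (logBarrier_nonneg (div_nonneg hx.1.le hτ0.le)))
    have h2 : W z - W (z - x) = C * x - ε * logBarrier (x / τ) := by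
      have hlt : x / τ < 1 := (div_lt_one hτ0).2 hx.2
      have hpos : 0 < τ - x := by linarith [hx.2]
      rw [logBarrier, if_pos hlt, one_sub_div hτ0.ne', Real.log_div hpos.ne' hτ0.ne']
      simp only [hW]
      rw [show z - x + 1 = τ - x by ring, show z + 1 = τ from rfl]
      ring
    rw [h2]
    refine le_trans (le_of_eq ?_) h1
    rw [← hlamC]; ring
  have hle := h.hasKernelIntegral_le hz (half_pos hτ0) hθ (by simp) (fun x hx => by
    have := hmax (z - x) ⟨by linarith [hx.2], by linarith [hx.1, hz.2]⟩
    linarith) hI (by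
    -- Excluding `x = τ` discards the time `-1`, about which neither `hmax` nor `hX` says anything.
    filter_upwards [ae_sub_left_of_ae_restrict_Iio hX z,
      (Measure.ae_ne volume τ)] with x hx hne hx0
    refine ⟨fun hxr => ?_, fun hxr => ?_⟩
    · rw [neg_sub]
      exact hnear x ⟨hx0, by linarith⟩
    · rcases lt_or_gt_of_ne hne with hlt | hgt
      · refine (hnear x ⟨hx0, hlt⟩).trans (pucci_mono hlam.le hLam ?_)
        have := hmax (z - x) ⟨by linarith, by linarith [hz.2]⟩
        linarith
      · rw [indicator_of_notMem (show x ∉ Ioc 0 τ from fun hc => by linarith [hc.2]),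
          indicator_of_mem (show x ∈ Ioi τ from hgt), logBarrier,
          if_neg (not_lt.2 ((one_le_div hτ0).2 hgt.le))]
        have h1 := sub_le_pucci hLam (p := C + ε * κ' + m) (by positivity) le_rfl
        have h2 : C + ε * κ' + m - 0 ≤ w z - w (z - x) := by
          have h3 := hx (by linarith)
          have h4 : w z = W z + m := by rw [hm]; ring
          have h5 : W z = X + C * (1 + τ) + ε * κ' + ε * (-Real.log τ) := by
            simp only [hW, ← hτ]
            rw [show (2 : ℝ) + z = 1 + τ by ring]; ring
          have h6 : 0 ≤ ε * (-Real.log τ) := mul_nonneg hε.le (by linarith)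
          have h7 : 0 ≤ C * τ := by positivity
          rw [h4, h5]
          linarith
        refine le_trans (le_of_eq ?_) (h1.trans (pucci_mono hlam.le hLam h2))
        rw [← hlamC]; ring)
  have hτα : 0 < τ ^ (-α) := Real.rpow_pos_of_pos hτ0 _
  have h1α : 0 < 1 - α := by linarith
  have e : F * (τ ^ (1 - α) / (1 - α)) + (-(Lam * ε) * (τ ^ (-α) * κ) +
      (F + lam * (ε * κ' + m)) * (τ ^ (-α) / α)) =
      F / (α * (1 - α)) * (α * τ ^ (1 - α) + (1 - α) * τ ^ (-α)) + lam * m * τ ^ (-α) / α := by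
    rw [hκ']; field_simp; ring
  rw [e] at hle
  have h8 := mul_le_mul_of_nonneg_left (one_le_weighted_rpow hα hα1 hτ0)
    (show 0 ≤ F / (α * (1 - α)) by positivity)
  have h9 : 0 < lam * m * τ ^ (-α) / α := by positivity
  linarith

theorem le_of_ae_le (h : IsExtremalSub lam Lam α F w) (hlam : 0 < lam) (hLam : lam ≤ Lam)
    (hα : 0 < α) (hα1 : α < 1) (hF : 0 ≤ F) {B X : ℝ} (hB : ∀ t ∈ Ioc (-1 : ℝ) 0, w t ≤ B)
    (hX : ∀ᵐ t ∂volume.restrict (Iio (-1)), w t ≤ X) {t : ℝ} (ht : t ∈ Ioc (-1 : ℝ) 0) :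
    w t ≤ X + 2 * F / lam := by
  set D := Lam * (∫ x in Ioi 0, logBarrier x * x ^ (-1 - α)) * α / lam - Real.log (t + 1) with hD
  have h1 : w t ≤ X + F / lam * (2 + t) := by
    refine le_of_forall_pos_le_add fun ε hε => ?_
    have h2 := h.le_barrier hlam hLam hα hα1 hF hB hX (ε := ε / (|D| + 1)) (by positivity) ht
    rw [← hD] at h2
    refine h2.trans (by
      gcongr
      rw [div_mul_eq_mul_div, div_le_iff₀ (by positivity)]
      gcongr
      linarith [le_abs_self D])
  have h3 : F / lam * (2 + t) ≤ F / lam * 2 :=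
    mul_le_mul_of_nonneg_left (by linarith [ht.2]) (by positivity)
  calc w t ≤ X + F / lam * 2 := by linarith
    _ = _ := by ring

end IsExtremalSub

/-! ### Increments of the modulus and one-point estimates -/

/-- Subadditivity of the power `γ`, then Bernoulli for the power `β / γ`. Passing from `β` to a
fixed `γ` keeps a factor `β` in front while remaining integrable at infinity when `γ < α`. -/
theorem one_add_rpow_sub_one_le {β γ x : ℝ} (hβ : 0 < β) (hβγ : β ≤ γ) (hγ : γ ≤ 1) (hx : 0 ≤ x) :
    (1 + x) ^ β - 1 ≤ β / γ * x ^ γ := by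
  have hγ0 : 0 < γ := hβ.trans_le hβγ
  have h1 : (1 + x) ^ β = ((1 + x) ^ γ) ^ (β / γ) := by
    rw [← Real.rpow_mul (by linarith), mul_div_cancel₀ _ hγ0.ne']
  have h2 : (1 + x) ^ γ ≤ 1 + x ^ γ := by
    simpa using Real.rpow_add_le_add_rpow zero_le_one hx hγ0.le hγ
  have h3 := Real.rpow_le_rpow (by positivity) h2 (div_pos hβ hγ0).le
  have hxγ : 0 ≤ x ^ γ := by positivity
  have h4 := rpow_one_add_le_one_add_mul_self (s := x ^ γ) (by linarith) (p := β / γ)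
    (by positivity) ((div_le_one hγ0).2 hβγ)
  linarith

theorem add_rpow_sub_rpow_le_mul_rpow {β γ d h : ℝ} (hβ : 0 < β) (hβγ : β ≤ γ) (hγ : γ ≤ 1)
    (hd : 0 < d) (hh : 0 ≤ h) : (d + h) ^ β - d ^ β ≤ β / γ * d ^ (β - γ) * h ^ γ := by
  have h1 := mul_le_mul_of_nonneg_left
    (one_add_rpow_sub_one_le hβ hβγ hγ (div_nonneg hh hd.le)) (Real.rpow_nonneg hd.le β)
  have h2 : d ^ β * (1 + h / d) ^ β = (d + h) ^ β := by
    rw [← Real.mul_rpow hd.le (by positivity), mul_add, mul_div_cancel₀ _ hd.ne', mul_one]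
  rw [mul_sub, h2, mul_one, Real.div_rpow hh hd.le] at h1
  refine h1.trans (le_of_eq ?_)
  rw [Real.rpow_sub hd]
  ring

theorem add_rpow_sub_rpow_le_mul {β d h : ℝ} (hβ : 0 ≤ β) (hβ1 : β ≤ 1) (hd : 0 < d)
    (hh : -d ≤ h) : (d + h) ^ β - d ^ β ≤ β * d ^ (β - 1) * h := by
  have hs : -1 ≤ h / d := by rw [le_div_iff₀ hd]; linarith
  have h1 := mul_le_mul_of_nonneg_left
    (rpow_one_add_le_one_add_mul_self hs hβ hβ1) (Real.rpow_nonneg hd.le β)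
  have h2 : d ^ β * (1 + h / d) ^ β = (d + h) ^ β := by
    rw [← Real.mul_rpow hd.le (by linarith), mul_add, mul_div_cancel₀ _ hd.ne', mul_one]
  rw [h2] at h1
  rw [Real.rpow_sub_one hd.ne']
  calc _ ≤ d ^ β * (1 + β * (h / d)) - d ^ β := by linarith
    _ = _ := by ring

/-- On `E` one has `h < 3 * d` and `1 + α < 2`, so the kernel is at least `d ^ (-1 - α) / 9`. -/
theorem HasKernelIntegral.exists_indicator_ge {α d ν : ℝ} {E : Set ℝ} (hα : 0 < α) (hα1 : α < 1)
    (hd : 0 < d) (hE : MeasurableSet E) (hEd : E ⊆ Ioo d (3 * d)) (hν : ν * d ≤ volume.real E) :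
    ∃ J, HasKernelIntegral α (E.indicator fun _ => 1) J ∧ ν / 9 * d ^ (-α) ≤ J := by
  have hi : IntegrableOn (fun h : ℝ => h ^ (-1 - α)) E :=
    (integral_Ioi_rpow_kernel hα hd).1.mono_set (hEd.trans Ioo_subset_Ioi_self)
  refine ⟨_, indicator_of hE (fun h hh => hd.trans (hEd hh).1) (by simpa using hi) rfl, ?_⟩
  have hfin : volume E ≠ ∞ := ((measure_mono hEd).trans_lt (by simp)).ne
  have h1 : volume.real E * (3 * d) ^ (-1 - α) ≤ ∫ h in E, 1 * h ^ (-1 - α) := by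
    rw [← smul_eq_mul, ← setIntegral_const]
    refine setIntegral_mono_on (integrableOn_const hfin) (by simpa using hi) hE fun h hh => ?_
    rw [one_mul]
    exact Real.rpow_le_rpow_of_nonpos (hd.trans (hEd hh).1) (hEd hh).2.le (by linarith)
  refine le_trans ?_ h1
  rcases le_or_gt ν 0 with h0 | h0
  · exact (mul_nonpos_of_nonpos_of_nonneg (by linarith) (by positivity)).trans (by positivity)
  have h3 : (1 : ℝ) / 9 ≤ 3 ^ (-1 - α) := by
    have := Real.rpow_le_rpow_of_exponent_le (x := 3) (by norm_num)
      (show (-2 : ℝ) ≤ -1 - α by linarith)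
    rw [Real.rpow_neg (by norm_num)] at this
    norm_num at this
    simpa using this
  have h4 : (3 * d) ^ (-1 - α) = 3 ^ (-1 - α) * d ^ (-1 - α) :=
    Real.mul_rpow (by norm_num) hd.le
  have h5 : d * d ^ (-1 - α) = d ^ (-α) := by
    rw [mul_comm, ← Real.rpow_add_one hd.ne']; ring_nf
  calc ν / 9 * d ^ (-α) = ν * d * (1 / 9 * d ^ (-1 - α)) := by rw [← h5]; ring
    _ ≤ volume.real E * (3 * d) ^ (-1 - α) := by
        rw [h4]; gcongr

theorem error_terms_le {Lam α₀ α M F : ℝ} (hLam : 0 < Lam) (hα₀ : 0 < α₀) (hα : α₀ ≤ α)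
    (hα1 : α < 1) (hM : 0 ≤ M) (hF : 0 ≤ F) :
    Lam * (64 * M) * ((1 / 4) ^ (1 - α) / (1 - α)) + Lam * (2 * M) * ((1 / 4) ^ (-α) / α) +
      F / (α * (1 - α)) ≤ (72 * Lam + 1) / α₀ * (M + F) / (1 - α) := by
  have hα0 : 0 < α := hα₀.trans_le hα
  have h1α : 0 < 1 - α := by linarith
  have h1 : ((1 : ℝ) / 4) ^ (1 - α) ≤ 1 :=
    Real.rpow_le_one (by norm_num) (by norm_num) h1α.le
  have h2 : ((1 : ℝ) / 4) ^ (-α) ≤ 4 := by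
    rw [one_div, Real.inv_rpow (by norm_num), ← Real.rpow_neg (by norm_num), neg_neg]
    simpa using Real.rpow_le_rpow_of_exponent_le (x := 4) (by norm_num) hα1.le
  have hα₀1 : α₀ ≤ 1 := by linarith
  have h3 : (1 : ℝ) ≤ 1 / α₀ := (one_le_div hα₀).2 hα₀1
  have h4 : (1 : ℝ) ≤ 1 / (1 - α) := (one_le_div h1α).2 (by linarith)
  have h5 : (1 : ℝ) / α ≤ 1 / α₀ := one_div_le_one_div_of_le hα₀ hα
  set q := 1 / (1 - α)
  set b := 1 / α₀
  have e1 : Lam * (64 * M) * ((1 / 4) ^ (1 - α) / (1 - α)) ≤ Lam * (64 * M) * (b * q) := by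
    have : ((1 : ℝ) / 4) ^ (1 - α) / (1 - α) ≤ b * q := by
      rw [div_eq_mul_one_div]
      gcongr
      exact h1.trans h3
    gcongr
  have e2 : Lam * (2 * M) * ((1 / 4) ^ (-α) / α) ≤ Lam * (2 * M) * (4 * b * q) := by
    have : ((1 : ℝ) / 4) ^ (-α) / α ≤ 4 * b * q := by
      rw [div_eq_mul_one_div]
      calc _ ≤ 4 * b := by gcongr
        _ ≤ 4 * b * q := le_mul_of_one_le_right (by positivity) h4
    gcongr
  have e3 : F / (α * (1 - α)) ≤ F * (b * q) := by
    have : F / (α * (1 - α)) = F * (1 / α * q) := by simp only [q]; field_simp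
    rw [this]
    gcongr
  have e4 : (72 * Lam + 1) / α₀ * (M + F) / (1 - α) = (72 * Lam + 1) * (M + F) * (b * q) := by
    simp only [b, q]; field_simp
  rw [e4]
  have hbq : 0 ≤ b * q := by positivity
  have h6 : 0 ≤ Lam * F * (b * q) := by positivity
  have h7 : 0 ≤ M * (b * q) := by positivity
  nlinarith

namespace IsExtremalSub

variable {lam Lam α α₀ β γ F M N : ℝ} {w : ℝ → ℝ}

/-- The common computation behind both mechanisms: `σ` measures the gain or loss on `(0, d]`, `τ`
the loss beyond `d`, and `e`, `ν` the drop on `E` and its density. The penalty and the tail beyond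
`1 / 4` form the right side. The profile is tested only up to `d / 2` because `|d - h| ^ β` is not
smooth at `h = d`. -/
theorem balance (h : IsExtremalSub lam Lam α F w) (hlam : 0 < lam) (hLam : lam ≤ Lam)
    (hα₀ : 0 < α₀) (hα : α₀ ≤ α) (hα1 : α < 1) (hγ : γ < α) (hF : 0 ≤ F) (hM : 0 ≤ M)
    {z d σ τ e ν : ℝ} {θ : ℝ → ℝ} {E : Set ℝ} (hz : z ∈ Icc (-3 / 4 : ℝ) 0)
    (hMz : ∀ᵐ t ∂volume.restrict (Iio 0), w t - w z ≤ 2 * M)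
    (hd : 0 < d) (hd1 : 3 * d ≤ 1 / 4) (hθ : ContDiffOn ℝ 1 θ (Icc 0 (d / 2))) (hθ0 : θ 0 = 0)
    (hle : ∀ h ∈ Icc 0 (d / 2), w (z - h) ≤ w z + θ h)
    (hτ : 0 ≤ τ) (he : 0 ≤ e)
    (htest : ∀ h ∈ Ioc 0 (d / 2), σ * d ^ (β - 1) * h - Lam * (64 * M) * h ≤ pucci lam Lam (-θ h))
    (hnear : ∀ h ∈ Ioc (d / 2) d,
      σ * d ^ (β - 1) * h - Lam * (64 * M) * h ≤ pucci lam Lam (w z - w (z - h)))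
    (hfar : ∀ h ∈ Ioo d (1 / 4),
      -(τ * d ^ (β - γ) * h ^ γ) - Lam * (64 * M) * h ≤ pucci lam Lam (w z - w (z - h)))
    (hE : MeasurableSet E) (hEd : E ⊆ Ioo d (3 * d)) (hEν : ν * d ≤ volume.real E)
    (hEe : ∀ h ∈ E, e * d ^ β ≤ w z - w (z - h)) :
    d ^ (β - α) * (σ / (1 - α) - τ / (α - γ) + lam * e * ν / 9) ≤
      (72 * Lam + 1) / α₀ * (M + F) / (1 - α) := by
  have hα0 : 0 < α := hα₀.trans_le hα
  have hLam0 : 0 < Lam := hlam.trans_le hLam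
  obtain ⟨J, hJ, hJν⟩ := HasKernelIntegral.exists_indicator_ge hα0 hα1 hd hE hEd hEν
  -- The minorant has five pieces: the modulus before and after `d`, the penalty up to `1 / 4`, the
  -- oscillation `2 * M` beyond, and the bonus on `E`.
  have hI := (((HasKernelIntegral.near hα1 hd).const_mul (σ * d ^ (β - 1))).add
    ((HasKernelIntegral.far_rpow hγ hd).const_mul (-(τ * d ^ (β - γ))))).add
    ((((HasKernelIntegral.near hα1 (a := 1 / 4) (by norm_num)).const_mul (-(Lam * (64 * M)))).add
    ((HasKernelIntegral.far hα0 (a := 1 / 4) (by norm_num)).const_mul (-(Lam * (2 * M))))).add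
    (hJ.const_mul (lam * (e * d ^ β))))
  have hdβ : 0 < d ^ β := Real.rpow_pos_of_pos hd _
  have hmain := h.hasKernelIntegral_le ⟨by linarith [hz.1], hz.2⟩ (half_pos hd) hθ hθ0 hle hI (by
    filter_upwards [ae_sub_left_of_ae_restrict_Iio hMz z] with x hx hx0
    have h0 : x ≤ d → x ∉ E ∧ x ∈ Ioc 0 d ∧ x ∉ Ioi d ∧
        x ∈ Ioc 0 (1 / 4 : ℝ) ∧ x ∉ Ioi (1 / 4 : ℝ) :=
      fun hxd => ⟨fun hc => by linarith [(hEd hc).1], ⟨hx0, hxd⟩, not_lt.2 hxd,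
        ⟨hx0, by linarith⟩, not_lt.2 (show x ≤ 1 / 4 by linarith)⟩
    refine ⟨fun hxr => ?_, fun hxr => ?_⟩
    · obtain ⟨m1, m2, m3, m4, m5⟩ := h0 (by linarith)
      simp only [indicator_of_mem, indicator_of_notMem, m1, m2, m3, m4, m5, not_false_eq_true]
      refine le_trans (le_of_eq ?_) (htest x ⟨hx0, hxr⟩)
      ring
    rcases le_or_gt x d with hxd | hxd
    · obtain ⟨m1, m2, m3, m4, m5⟩ := h0 hxd
      simp only [indicator_of_mem, indicator_of_notMem, m1, m2, m3, m4, m5, not_false_eq_true]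
      refine le_trans (le_of_eq ?_) (hnear x ⟨hxr, hxd⟩)
      ring
    have m2 : x ∉ Ioc 0 d := fun hc => by linarith [hc.2]
    have m3 : x ∈ Ioi d := hxd
    have hτx : 0 ≤ τ * d ^ (β - γ) * x ^ γ := by positivity
    rcases lt_or_ge x (1 / 4) with hx4 | hx4
    · have m4 : x ∈ Ioc 0 (1 / 4 : ℝ) := ⟨hx0, hx4.le⟩
      have m5 : x ∉ Ioi (1 / 4 : ℝ) := not_lt.2 hx4.le
      by_cases m1 : x ∈ E
      · simp only [indicator_of_mem, indicator_of_notMem, m1, m2, m3, m4, m5, not_false_eq_true]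
        have h1 := sub_le_pucci hLam (p := e * d ^ β) (by positivity) le_rfl
        rw [sub_zero] at h1
        have h2 : 0 ≤ Lam * (64 * M) * x := by positivity
        refine le_trans ?_ (h1.trans (pucci_mono hlam.le hLam (hEe x m1)))
        linarith
      · simp only [indicator_of_mem, indicator_of_notMem, m1, m2, m3, m4, m5, not_false_eq_true]
        refine le_trans (le_of_eq ?_) (hfar x ⟨hxd, hx4⟩)
        ring
    · have m1 : x ∉ E := fun hc => by linarith [(hEd hc).2]
      have h1 := sub_le_pucci hLam (q := 2 * M) le_rfl (by positivity)
      have h2 := pucci_mono hlam.le hLam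
        (show 0 - 2 * M ≤ w z - w (z - x) by linarith [hx (by linarith [hz.2])])
      have h3 : (Ioc 0 (1 / 4)).indicator (fun h => h) x * (Lam * (64 * M)) +
          (Ioi (1 / 4)).indicator (fun _ => 1) x * (Lam * (2 * M)) ≥ Lam * (2 * M) := by
        rcases hx4.eq_or_lt with h4 | h4
        · rw [← h4, indicator_of_mem (by norm_num), indicator_of_notMem (by simp)]
          nlinarith
        · rw [indicator_of_notMem (fun hc => by linarith [hc.2]),
            indicator_of_mem (show x ∈ Ioi (1 / 4 : ℝ) from h4)]
          linarith
      rw [indicator_of_notMem m1, indicator_of_notMem m2, indicator_of_mem m3]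
      linarith)
  have herr := error_terms_le hLam0 hα₀ hα hα1 hM hF
  have e1 : d ^ (β - 1) * d ^ (1 - α) = d ^ (β - α) := by
    rw [← Real.rpow_add hd]; ring_nf
  have e2 : d ^ (β - γ) * d ^ (γ - α) = d ^ (β - α) := by
    rw [← Real.rpow_add hd]; ring_nf
  have e3 : d ^ β * d ^ (-α) = d ^ (β - α) := by
    rw [← Real.rpow_add hd]; ring_nf
  have e4 : d ^ (β - α) * (σ / (1 - α) - τ / (α - γ) + lam * e * ν / 9) =
      σ * d ^ (β - 1) * (d ^ (1 - α) / (1 - α)) +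
      -(τ * d ^ (β - γ)) * (d ^ (γ - α) / (α - γ)) +
      lam * (e * d ^ β) * (ν / 9 * d ^ (-α)) := by
    calc _ = d ^ (β - α) * (σ / (1 - α)) - d ^ (β - α) * (τ / (α - γ)) +
          d ^ (β - α) * (lam * e * ν / 9) := by ring
      _ = d ^ (β - 1) * d ^ (1 - α) * (σ / (1 - α)) -
          d ^ (β - γ) * d ^ (γ - α) * (τ / (α - γ)) +
          d ^ β * d ^ (-α) * (lam * e * ν / 9) := by rw [e1, e2, e3]
      _ = _ := by ring
  have e5 := mul_le_mul_of_nonneg_left hJν (show 0 ≤ lam * (e * d ^ β) by positivity)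
  rw [e4]
  linarith

/-- Estimate at the later point of a doubling maximum, from the concavity of the modulus. -/
theorem balance_of_concave (h : IsExtremalSub lam Lam α F w) (hlam : 0 < lam) (hLam : lam ≤ Lam)
    (hα₀ : 0 < α₀) (hα : α₀ ≤ α) (hα1 : α < 1) (hβ : 0 < β) (hβγ : β ≤ γ) (hγ : γ < α)
    (hF : 0 ≤ F) (hM : 0 ≤ M) (hN : 0 ≤ N) {z d : ℝ} {θ : ℝ → ℝ} (hz : z ∈ Icc (-3 / 4 : ℝ) 0)
    (hMz : ∀ᵐ t ∂volume.restrict (Iio 0), w t - w z ≤ 2 * M)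
    (hd : 0 < d) (hd1 : 3 * d ≤ 1 / 4) (hθ : ContDiffOn ℝ 1 θ (Icc 0 (d / 2))) (hθ0 : θ 0 = 0)
    (hle : ∀ h ∈ Icc 0 (d / 2), w (z - h) ≤ w z + θ h)
    (hθle : ∀ h ∈ Ioc 0 (d / 2), θ h ≤ N * |d - h| ^ β - N * d ^ β + 64 * M * h)
    (hw : ∀ h ∈ Ioo 0 (1 / 4), w (z - h) ≤ w z + (N * |d - h| ^ β - N * d ^ β + 64 * M * h)) :
    d ^ (β - α) * (lam * N * β / (1 - α) - Lam * N * (β / γ) / (α - γ)) ≤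
      (72 * Lam + 1) / α₀ * (M + F) / (1 - α) := by
  have hγ0 : 0 < γ := hβ.trans_le hβγ
  have hLam0 : 0 < Lam := hlam.trans_le hLam
  have key : ∀ x ∈ Ioc 0 d, ∀ y, y ≤ N * |d - x| ^ β - N * d ^ β + 64 * M * x →
      lam * N * β * d ^ (β - 1) * x - Lam * (64 * M) * x ≤ pucci lam Lam (-y) := by
    intro x hx y hy
    rw [abs_of_nonneg (by linarith [hx.2])] at hy
    have h1 := mul_le_mul_of_nonneg_left (add_rpow_sub_rpow_le_mul hβ.le (by linarith) hd
      (h := -x) (by linarith [hx.2])) hN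
    rw [← sub_eq_add_neg] at h1
    have hx0 := hx.1
    have h2 := sub_le_pucci hLam (p := N * β * d ^ (β - 1) * x) (q := 64 * M * x)
      (by positivity) (by positivity)
    refine le_trans (le_of_eq ?_) (h2.trans (pucci_mono hlam.le hLam ?_))
    · ring
    · linarith
  have := h.balance (β := β) (E := ∅) (e := 0) (ν := 0) (σ := lam * N * β)
    (τ := Lam * N * (β / γ)) hlam hLam hα₀ hα
    hα1 hγ hF hM hz hMz hd hd1 hθ hθ0 hle (by positivity) le_rfl
    (fun x hx => key x ⟨hx.1, by linarith [hx.2]⟩ _ (hθle x hx))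
    (fun x hx => by
      have hx0 : 0 < x := by linarith [hx.1]
      have := key x ⟨hx0, hx.2⟩ (w (z - x) - w z)
        (by linarith [hw x ⟨hx0, by linarith [hx.2]⟩])
      rwa [neg_sub] at this)
    (fun x hx => by
      have hx0 : 0 < x := hd.trans hx.1
      have h1 := hw x ⟨hx0, hx.2⟩
      have h2 : |d - x| ^ β ≤ (d + x) ^ β := by
        refine Real.rpow_le_rpow (abs_nonneg _) ?_ hβ.le
        rw [abs_le]; constructor <;> linarith
      have h3 := add_rpow_sub_rpow_le_mul_rpow hβ hβγ (by linarith) hd hx0.le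
      have h4 := mul_le_mul_of_nonneg_left (h3.trans' (sub_le_sub_right h2 _)) hN
      have h5 := sub_le_pucci hLam (q := N * (β / γ * d ^ (β - γ) * x ^ γ) + 64 * M * x)
        le_rfl (by positivity)
      refine le_trans (le_of_eq ?_) (h5.trans (pucci_mono hlam.le hLam ?_))
      · ring
      · linarith) MeasurableSet.empty (empty_subset _) (by simp) (by simp)
  simpa using this

/-- Estimate at a point of a doubling maximum that sees a drop of half the modulus on a set of
definite density. -/
theorem balance_of_density (h : IsExtremalSub lam Lam α F w) (hlam : 0 < lam) (hLam : lam ≤ Lam)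
    (hα₀ : 0 < α₀) (hα : α₀ ≤ α) (hα1 : α < 1) (hβ : 0 < β) (hβγ : β ≤ γ) (hγ : γ < α)
    (hF : 0 ≤ F) (hM : 0 ≤ M) (hN : 0 ≤ N) {z d : ℝ} {θ : ℝ → ℝ} {E : Set ℝ}
    (hz : z ∈ Icc (-3 / 4 : ℝ) 0)
    (hMz : ∀ᵐ t ∂volume.restrict (Iio 0), w t - w z ≤ 2 * M)
    (hd : 0 < d) (hd1 : 3 * d ≤ 1 / 4) (hθ : ContDiffOn ℝ 1 θ (Icc 0 (d / 2))) (hθ0 : θ 0 = 0)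
    (hle : ∀ h ∈ Icc 0 (d / 2), w (z - h) ≤ w z + θ h)
    (hθle : ∀ h ∈ Ioc 0 (d / 2), θ h ≤ N * (d + h) ^ β - N * d ^ β + 64 * M * h)
    (hw : ∀ h ∈ Ioo 0 (1 / 4), w (z - h) ≤ w z + (N * (d + h) ^ β - N * d ^ β + 64 * M * h))
    (hE : MeasurableSet E) (hEd : E ⊆ Ioo d (3 * d)) (hEν : 1 / 2 * d ≤ volume.real E)
    (hEe : ∀ h ∈ E, N / 2 * d ^ β ≤ w z - w (z - h)) :
    d ^ (β - α) * (lam * N / 36 - Lam * N * β / (1 - α) - Lam * N * (β / γ) / (α - γ)) ≤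
      (72 * Lam + 1) / α₀ * (M + F) / (1 - α) := by
  have hγ0 : 0 < γ := hβ.trans_le hβγ
  have hLam0 : 0 < Lam := hlam.trans_le hLam
  have key : ∀ x, 0 < x → ∀ y, y ≤ N * (d + x) ^ β - N * d ^ β + 64 * M * x →
      -(Lam * N * β) * d ^ (β - 1) * x - Lam * (64 * M) * x ≤ pucci lam Lam (-y) := by
    intro x hx0 y hy
    have h1 := mul_le_mul_of_nonneg_left (add_rpow_sub_rpow_le_mul hβ.le (by linarith) hd
      (h := x) (by linarith)) hN
    have h2 := sub_le_pucci hLam (q := N * β * d ^ (β - 1) * x + 64 * M * x) le_rfl (by positivity)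
    refine le_trans (le_of_eq ?_) (h2.trans (pucci_mono hlam.le hLam ?_))
    · ring
    · linarith
  have := h.balance (β := β) (e := N / 2) (ν := 1 / 2) (σ := -(Lam * N * β))
    (τ := Lam * N * (β / γ)) hlam hLam hα₀ hα
    hα1 hγ hF hM hz hMz hd hd1 hθ hθ0 hle (by positivity) (by positivity)
    (fun x hx => key x hx.1 _ (hθle x hx))
    (fun x hx => by
      have hx0 : 0 < x := by linarith [hx.1]
      have := key x hx0 (w (z - x) - w z)
        (by linarith [hw x ⟨hx0, by linarith [hx.2]⟩])
      rwa [neg_sub] at this)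
    (fun x hx => by
      have hx0 : 0 < x := hd.trans hx.1
      have h1 := hw x ⟨hx0, hx.2⟩
      have h4 := mul_le_mul_of_nonneg_left
        (add_rpow_sub_rpow_le_mul_rpow hβ hβγ (by linarith) hd hx0.le) hN
      have h5 := sub_le_pucci hLam (q := N * (β / γ * d ^ (β - γ) * x ^ γ) + 64 * M * x)
        le_rfl (by positivity)
      refine le_trans (le_of_eq ?_) (h5.trans (pucci_mono hlam.le hLam ?_))
      · ring
      · linarith) hE hEd hEν hEe
  refine le_trans (le_of_eq ?_) this
  ring

end IsExtremalSub

/-! ### Choice of constants -/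

/-- Compatibility of the constants in the Hölder estimate: exponent `β`, threshold `κ` for
`1 - α`, and size `N` of the modulus. -/
structure HolderConstants (lam Lam γ κ β F M N : ℝ) : Prop where
  lam_pos : 0 < lam
  lam_le : lam ≤ Lam
  kappa_pos : 0 < κ
  beta_pos : 0 < β
  beta_le : β ≤ γ
  gamma_le : γ ≤ 1 / 2
  F_nonneg : 0 ≤ F
  M_pos : 0 < M
  kappa_le : 2 * κ * Lam ≤ lam * γ ^ 2
  beta_small : Lam * β * (1 / κ + 1 / γ ^ 2) ≤ lam / 72
  N_concave : (72 * Lam + 1) / (2 * γ) * (M + F) < N * lam * β / 2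
  N_density : (72 * Lam + 1) / (2 * γ) * (M + F) / κ < N * lam / 72
  N_large : 24 * M ≤ N

namespace HolderConstants

variable {lam Lam γ κ β F M N α d : ℝ}

theorem gamma_pos (H : HolderConstants lam Lam γ κ β F M N) : 0 < γ := H.beta_pos.trans_le H.beta_le

theorem N_pos (H : HolderConstants lam Lam γ κ β F M N) : 0 < N := by
  linarith [H.N_large, H.M_pos]

theorem one_le_rpow (H : HolderConstants lam Lam γ κ β F M N) (hα : 2 * γ ≤ α) (hd : 0 < d)
    (hd1 : d ≤ 1) : 1 ≤ d ^ (β - α) :=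
  Real.one_le_rpow_of_pos_of_le_one_of_nonpos hd hd1
    (by linarith [H.beta_le, H.gamma_pos])

theorem div_sub_le (H : HolderConstants lam Lam γ κ β F M N) (hα : 2 * γ ≤ α) :
    Lam * N * (β / γ) / (α - γ) ≤ N * (Lam * β * (1 / γ ^ 2)) := by
  have hγ := H.gamma_pos
  have hN := H.N_pos
  have hL : 0 < Lam := H.lam_pos.trans_le H.lam_le
  have hβ := H.beta_pos
  calc _ ≤ Lam * N * (β / γ) / γ := by
        gcongr; linarith
    _ = _ := by field_simp

/-- Gain and loss are both proportional to `N * β`. Since `1 - α ≤ κ`, the loss is at most half of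
the gain; the remaining `N * lam * β / 2 / (1 - α)` exceeds the error, which carries the same factor
`1 / (1 - α)`. -/
theorem not_concave (H : HolderConstants lam Lam γ κ β F M N) (hα : 2 * γ ≤ α) (hα1 : α < 1)
    (hd : 0 < d) (hd1 : d ≤ 1) (hκ : 1 - α ≤ κ)
    (h : d ^ (β - α) * (lam * N * β / (1 - α) - Lam * N * (β / γ) / (α - γ)) ≤
      (72 * Lam + 1) / (2 * γ) * (M + F) / (1 - α)) : False := by
  have h1α : 0 < 1 - α := by linarith
  have hγ := H.gamma_pos
  have hN := H.N_pos
  have hβ := H.beta_pos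
  have hlam := H.lam_pos
  have hL : 0 < Lam := H.lam_pos.trans_le H.lam_le
  have h1 : Lam * (1 / γ ^ 2) ≤ lam / (2 * (1 - α)) := by
    rw [mul_one_div, div_le_div_iff₀ (by positivity) (by positivity)]
    have := H.kappa_le
    nlinarith
  have h2 : N * (Lam * β * (1 / γ ^ 2)) ≤ lam * N * β / (1 - α) / 2 := by
    calc _ = N * β * (Lam * (1 / γ ^ 2)) := by ring
      _ ≤ N * β * (lam / (2 * (1 - α))) := by gcongr
      _ = _ := by field_simp
  have h3 : N * lam * β / 2 / (1 - α) ≤ lam * N * β / (1 - α) - Lam * N * (β / γ) / (α - γ) := by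
    have := H.div_sub_le hα
    have e : N * lam * β / 2 / (1 - α) = lam * N * β / (1 - α) / 2 := by ring
    rw [e]
    linarith
  have h4 : 0 ≤ N * lam * β / 2 / (1 - α) := by positivity
  have h5 := le_mul_of_one_le_left (h4.trans h3) (H.one_le_rpow hα hd hd1)
  have h6 := h3.trans (h5.trans h)
  rw [div_le_div_iff_of_pos_right h1α] at h6
  linarith [H.N_concave]

/-- Since `1 - α ≥ κ`, the losses are at most `N * Lam * β * (1 / κ + 1 / γ ^ 2)`, half of the gain
`lam * N / 36` by the choice of `β`. -/
theorem not_density (H : HolderConstants lam Lam γ κ β F M N) (hα : 2 * γ ≤ α)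
    (hd : 0 < d) (hd1 : d ≤ 1) (hκ : κ ≤ 1 - α)
    (h : d ^ (β - α) * (lam * N / 36 - Lam * N * β / (1 - α) - Lam * N * (β / γ) / (α - γ)) ≤
      (72 * Lam + 1) / (2 * γ) * (M + F) / (1 - α)) : False := by
  have hκ0 := H.kappa_pos
  have hγ := H.gamma_pos
  have hN := H.N_pos
  have hβ := H.beta_pos
  have hlam := H.lam_pos
  have hL : 0 < Lam := H.lam_pos.trans_le H.lam_le
  have hM := H.M_pos
  have hF := H.F_nonneg
  have h1 : Lam * N * β / (1 - α) ≤ N * (Lam * β * (1 / κ)) := by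
    calc _ ≤ Lam * N * β / κ := by gcongr
      _ = _ := by ring
  have h2 := H.div_sub_le hα
  have h3 := mul_le_mul_of_nonneg_left H.beta_small hN.le
  rw [mul_add, mul_add] at h3
  have h4 : N * lam / 72 ≤
      lam * N / 36 - Lam * N * β / (1 - α) - Lam * N * (β / γ) / (α - γ) := by linarith
  have h5 := le_mul_of_one_le_left ((show 0 ≤ N * lam / 72 by positivity).trans h4)
    (H.one_le_rpow hα hd hd1)
  have h6 : (72 * Lam + 1) / (2 * γ) * (M + F) / (1 - α) ≤
      (72 * Lam + 1) / (2 * γ) * (M + F) / κ := by gcongr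
  linarith [H.N_density]

end HolderConstants

/-! ### Doubling of variables -/

theorem volume_real_preimage_sub_left (s : Set ℝ) (hs : MeasurableSet s) (z : ℝ) :
    volume.real ((fun h => z - h) ⁻¹' s) = volume.real s := by
  rw [measureReal_def, measureReal_def,
    (Measure.measurePreserving_sub_left volume z).measure_preimage hs.nullMeasurableSet]

namespace IsExtremalSub

variable {lam Lam γ κ β F M N α : ℝ} {w : ℝ → ℝ}

theorem not_doubling_max (h₁ : IsExtremalSub lam Lam α F w)
    (h₂ : IsExtremalSub lam Lam α F fun t => -w t) (H : HolderConstants lam Lam γ κ β F M N)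
    (hα : 2 * γ ≤ α) (hα1 : α < 1) (hM : ∀ t ∈ Ioc (-1 : ℝ) 0, |w t| ≤ M)
    (hMae : ∀ᵐ t ∂volume.restrict (Iio 0), |w t| ≤ M) {t₀ S T : ℝ} (ht₀ : t₀ ∈ Icc (-1 / 2 : ℝ) 0)
    (hS : S ∈ Icc (-3 / 4 : ℝ) 0) (hT : T ∈ Icc (-3 / 4 : ℝ) 0) (hST : S < T)
    (hpos : 0 < w T - w S - (N * (T - S) ^ β + 32 * M * ((T - t₀) ^ 2 + (S - t₀) ^ 2)))
    (hmax : ∀ t ∈ Ioc (-1 : ℝ) 0, ∀ s ∈ Ioc (-1 : ℝ) 0,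
      w t - w s - (N * |t - s| ^ β + 32 * M * ((t - t₀) ^ 2 + (s - t₀) ^ 2)) ≤
        w T - w S - (N * (T - S) ^ β + 32 * M * ((T - t₀) ^ 2 + (S - t₀) ^ 2))) : False := by
  have hM0 := H.M_pos
  have hN0 := H.N_pos
  have hβ := H.beta_pos
  have hγ0 := H.gamma_pos
  have hβ1 : β ≤ 1 := by linarith [H.beta_le, H.gamma_le]
  have hS' : S ∈ Ioc (-1 : ℝ) 0 := ⟨by linarith [hS.1], hS.2⟩
  have hT' : T ∈ Ioc (-1 : ℝ) 0 := ⟨by linarith [hT.1], hT.2⟩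
  obtain ⟨d, hd⟩ : ∃ d, d = T - S := ⟨_, rfl⟩
  rw [← hd] at hpos hmax
  have hd0 : 0 < d := by linarith
  have hgap : N * d ^ β < w T - w S := by
    have : 0 ≤ 32 * M * ((T - t₀) ^ 2 + (S - t₀) ^ 2) := by positivity
    linarith
  -- From `N * d ^ β < 2 * M` and `24 * M ≤ N`; it puts `(d, 3 * d)` inside the window `h < 1 / 4`.
  have hd12 : d ≤ 1 / 12 := by
    by_contra! hc
    have h1 : d ≤ d ^ β := by
      simpa using Real.rpow_le_rpow_of_exponent_ge hd0 (by linarith [hS.1, hT.2]) hβ1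
    have h2 := (abs_le.1 (hM T hT')).2
    have h3 := (abs_le.1 (hM S hS')).1
    have h4 : N * (1 / 12) ≤ N * d ^ β := by gcongr; linarith
    linarith [H.N_large]
  have hpen : ∀ z ∈ Icc (-3 / 4 : ℝ) 0, ∀ x ∈ Icc (0 : ℝ) (1 / 4),
      32 * M * ((z - x - t₀) ^ 2 - (z - t₀) ^ 2) ≤ 64 * M * x := by
    intro z hz x hx
    have : (z - x - t₀) ^ 2 - (z - t₀) ^ 2 ≤ 2 * x := by
      nlinarith [hz.1, hz.2, hx.1, hx.2, ht₀.1, ht₀.2]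
    nlinarith
  have hwT : ∀ x ∈ Ico 0 (1 / 4 : ℝ), w (T - x) ≤ w T +
      (N * |d - x| ^ β - N * d ^ β + 32 * M * ((T - x - t₀) ^ 2 - (T - t₀) ^ 2)) := by
    intro x hx
    have := hmax (T - x) ⟨by linarith [hx.2, hT.1], by linarith [hx.1, hT.2]⟩ S hS'
    rw [show T - x - S = d - x by rw [hd]; ring] at this
    linarith
  have hwS : ∀ x ∈ Ico 0 (1 / 4 : ℝ), -w (S - x) ≤ -w S +
      (N * (d + x) ^ β - N * d ^ β + 32 * M * ((S - x - t₀) ^ 2 - (S - t₀) ^ 2)) := by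
    intro x hx
    have := hmax T hT' (S - x) ⟨by linarith [hx.2, hS.1], by linarith [hx.1, hS.2]⟩
    rw [show T - (S - x) = d + x by rw [hd]; ring, abs_of_nonneg (by linarith [hx.1])] at this
    linarith
  have hMT : ∀ᵐ t ∂volume.restrict (Iio 0), w t - w T ≤ 2 * M := by
    filter_upwards [hMae] with t ht
    linarith [(abs_le.1 ht).2, (abs_le.1 (hM T hT')).1]
  have hMS : ∀ᵐ t ∂volume.restrict (Iio 0), -w t - -w S ≤ 2 * M := by
    filter_upwards [hMae] with t ht
    linarith [(abs_le.1 ht).1, (abs_le.1 (hM S hS')).2]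
  have hθT : ContDiffOn ℝ 1 (fun x => N * (d - x) ^ β - N * d ^ β +
      32 * M * ((T - x - t₀) ^ 2 - (T - t₀) ^ 2)) (Icc 0 (d / 2)) := by
    have : ∀ x ∈ Icc 0 (d / 2), d - x ≠ 0 := fun x hx => by linarith [hx.2]
    have h := (contDiffOn_const.sub contDiffOn_id : ContDiffOn ℝ 1 (fun x => d - x)
      (Icc 0 (d / 2))).rpow_const_of_ne (p := β) this
    fun_prop
  have hθS : ContDiffOn ℝ 1 (fun x => N * (d + x) ^ β - N * d ^ β +
      32 * M * ((S - x - t₀) ^ 2 - (S - t₀) ^ 2)) (Icc 0 (d / 2)) := by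
    have : ∀ x ∈ Icc 0 (d / 2), d + x ≠ 0 := fun x hx => by linarith [hx.1]
    have h := (contDiffOn_const.add contDiffOn_id : ContDiffOn ℝ 1 (fun x => d + x)
      (Icc 0 (d / 2))).rpow_const_of_ne (p := β) this
    fun_prop
  have hleT : ∀ x ∈ Icc 0 (d / 2), w (T - x) ≤ w T + (N * (d - x) ^ β - N * d ^ β +
      32 * M * ((T - x - t₀) ^ 2 - (T - t₀) ^ 2)) := by
    intro x hx
    have := hwT x ⟨hx.1, by linarith [hx.2]⟩
    rwa [abs_of_nonneg (by linarith [hx.2])] at this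
  have hleS := fun x (hx : x ∈ Icc 0 (d / 2)) => hwS x ⟨hx.1, by linarith [hx.2]⟩
  have hwT' : ∀ x ∈ Ioo 0 (1 / 4 : ℝ), w (T - x) ≤ w T +
      (N * |d - x| ^ β - N * d ^ β + 64 * M * x) := fun x hx => by
    linarith [hwT x ⟨hx.1.le, hx.2⟩, hpen T hT x ⟨hx.1.le, hx.2.le⟩]
  have hwS' : ∀ x ∈ Ioo 0 (1 / 4 : ℝ), -w (S - x) ≤ -w S +
      (N * (d + x) ^ β - N * d ^ β + 64 * M * x) := fun x hx => by
    linarith [hwS x ⟨hx.1.le, hx.2⟩, hpen S hS x ⟨hx.1.le, hx.2.le⟩]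
  have hγα : γ < α := by linarith
  rcases le_total (1 - α) κ with hκ | hκ
  · exact H.not_concave hα hα1 hd0 (by linarith) hκ
      (h₁.balance_of_concave H.lam_pos H.lam_le (by linarith) hα hα1 hβ H.beta_le hγα H.F_nonneg
        hM0.le hN0.le hT hMT hd0 (by linarith) hθT (by simp) hleT
        (fun x hx => by
          have := hpen T hT x ⟨hx.1.le, by linarith [hx.2]⟩
          rw [abs_of_nonneg (by linarith [hx.2])]
          linarith) hwT')
  -- By upper semicontinuity the set where `w` is below the mean value is relatively open, hence
  -- measurable.
  · obtain ⟨U, hU, hUJ⟩ := upperSemicontinuousOn_iff_preimage_Iio.1 h₁.usc ((w T + w S) / 2)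
    -- This interval lies at distances `(2 * d, 3 * d)` from `T` and `(d, 2 * d)` from `S`, so it
    -- serves both points. One of the two sets into which `U` splits it has measure at least `d /
    -- 2`.
    have hJsub : Ioo (S - 2 * d) (S - d) ⊆ Ioc (-1 : ℝ) 0 := fun s hs =>
      ⟨by linarith [hs.1, hS.1], by linarith [hs.2, hS.2]⟩
    have hUiff : ∀ s ∈ Ioo (S - 2 * d) (S - d), s ∈ U ↔ w s < (w T + w S) / 2 := by
      intro s hs
      have := Set.ext_iff.1 hUJ s
      simpa [hJsub hs, (hJsub hs).1, (hJsub hs).2] using this.symm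
    have hm1 : MeasurableSet (Ioo (S - 2 * d) (S - d) ∩ U) := measurableSet_Ioo.inter hU.measurableSet
    have hm2 : MeasurableSet (Ioo (S - 2 * d) (S - d) \ U) := measurableSet_Ioo.diff hU.measurableSet
    have hsum := measureReal_inter_add_sdiff (μ := volume) (s := Ioo (S - 2 * d) (S - d))
      hU.measurableSet (by simp)
    rw [Real.volume_real_Ioo_of_le (by linarith)] at hsum
    rcases le_total (1 / 2 * d) (volume.real (Ioo (S - 2 * d) (S - d) ∩ U)) with hE | hE
    · rw [← volume_real_preimage_sub_left _ hm1 T] at hE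
      exact H.not_density hα hd0 (by linarith) hκ
        (h₁.balance_of_density H.lam_pos H.lam_le (by linarith) hα hα1 hβ H.beta_le hγα H.F_nonneg
          hM0.le hN0.le hT hMT hd0 (by linarith) hθT (by simp) hleT
          (fun x hx => by
            have := hpen T hT x ⟨hx.1.le, by linarith [hx.2]⟩
            have h2 : (d - x) ^ β ≤ (d + x) ^ β :=
              Real.rpow_le_rpow (by linarith [hx.2]) (by linarith [hx.1]) hβ.le
            have := mul_le_mul_of_nonneg_left h2 hN0.le
            linarith)
          (fun x hx => by
            refine (hwT' x hx).trans ?_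
            have h2 : |d - x| ^ β ≤ (d + x) ^ β := by
              refine Real.rpow_le_rpow (abs_nonneg _) ?_ hβ.le
              rw [abs_le]; constructor <;> linarith [hx.1]
            have := mul_le_mul_of_nonneg_left h2 hN0.le
            linarith)
          (hm1.preimage (by fun_prop))
          (fun x hx => ⟨by linarith [hx.1.2], by linarith [hx.1.1]⟩) hE
          (fun x hx => by
            have := (hUiff _ hx.1).1 hx.2
            linarith))
    · replace hE : 1 / 2 * d ≤ volume.real (Ioo (S - 2 * d) (S - d) \ U) := by linarith
      rw [← volume_real_preimage_sub_left _ hm2 S] at hE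
      exact H.not_density hα hd0 (by linarith) hκ
        (h₂.balance_of_density H.lam_pos H.lam_le (by linarith) hα hα1 hβ H.beta_le hγα H.F_nonneg
          hM0.le hN0.le hS hMS hd0 (by linarith) hθS (by simp) hleS
          (fun x hx => by
            have := hpen S hS x ⟨hx.1.le, by linarith [hx.2]⟩
            linarith)
          hwS' (hm2.preimage (by fun_prop))
          (fun x hx => ⟨by linarith [hx.1.2], by linarith [hx.1.1]⟩) hE
          (fun x hx => by
            have := not_lt.1 ((hUiff _ hx.1).not.1 hx.2)
            linarith))

/-- The weight `32 * M` makes the penalty at least `2 * M` as soon as `t` or `s` leaves `[-3/4, 0]`,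
a distance `1 / 4` from `t₀`. A violation therefore forces a positive maximum in the compact square.
-/
theorem sub_le_modulus (h₁ : IsExtremalSub lam Lam α F w)
    (h₂ : IsExtremalSub lam Lam α F fun t => -w t) (H : HolderConstants lam Lam γ κ β F M N)
    (hα : 2 * γ ≤ α) (hα1 : α < 1) (hM : ∀ t ∈ Ioc (-1 : ℝ) 0, |w t| ≤ M)
    (hMae : ∀ᵐ t ∂volume.restrict (Iio 0), |w t| ≤ M) {t₀ : ℝ} (ht₀ : t₀ ∈ Icc (-1 / 2 : ℝ) 0) :
    ∀ t ∈ Ioc (-1 : ℝ) 0, ∀ s ∈ Ioc (-1 : ℝ) 0,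
      w t - w s ≤ N * |t - s| ^ β + 32 * M * ((t - t₀) ^ 2 + (s - t₀) ^ 2) := by
  have hM0 := H.M_pos
  have hN0 := H.N_pos
  have hβ := H.beta_pos
  set Ψ : ℝ × ℝ → ℝ := fun p => N * |p.1 - p.2| ^ β + 32 * M * ((p.1 - t₀) ^ 2 + (p.2 - t₀) ^ 2)
    with hΨ
  have hout : ∀ t ∈ Ioc (-1 : ℝ) 0, ∀ s ∈ Ioc (-1 : ℝ) 0,
      (t, s) ∉ Icc (-3 / 4 : ℝ) 0 ×ˢ Icc (-3 / 4 : ℝ) 0 → w t - w s ≤ Ψ (t, s) := by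
    intro t ht s hs hts
    have h1 : w t - w s ≤ 2 * M := by
      linarith [(abs_le.1 (hM t ht)).2, (abs_le.1 (hM s hs)).1]
    have h2 : (1 : ℝ) / 16 ≤ (t - t₀) ^ 2 + (s - t₀) ^ 2 := by
      rcases lt_or_ge t (-3 / 4) with h | h
      · nlinarith [ht₀.1, sq_nonneg (s - t₀)]
      · have : s < -3 / 4 := by
          by_contra! hc
          exact hts ⟨⟨h, ht.2⟩, ⟨hc, hs.2⟩⟩
        nlinarith [ht₀.1, sq_nonneg (t - t₀)]
    have h3 : 0 ≤ N * |t - s| ^ β := by positivity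
    simp only [hΨ]
    nlinarith
  have hsub : Icc (-3 / 4 : ℝ) 0 ⊆ Ioc (-1 : ℝ) 0 := fun s hs => ⟨by linarith [hs.1], hs.2⟩
  have husc : UpperSemicontinuousOn (fun p : ℝ × ℝ => (w p.1 + -w p.2) - Ψ p)
      (Icc (-3 / 4 : ℝ) 0 ×ˢ Icc (-3 / 4 : ℝ) 0) := by
    refine UpperSemicontinuousOn.sub_continuousOn (UpperSemicontinuousOn.add ?_ ?_) ?_
    · exact h₁.usc.comp continuousOn_fst fun p hp => hsub hp.1
    · exact h₂.usc.comp continuousOn_snd fun p hp => hsub hp.2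
    · refine Continuous.continuousOn ?_
      have : Continuous fun p : ℝ × ℝ => |p.1 - p.2| ^ β :=
        Continuous.rpow_const (by fun_prop) fun _ => Or.inr hβ.le
      fun_prop
  obtain ⟨⟨T, S⟩, ⟨hT, hS⟩, hmax⟩ := husc.exists_isMaxOn
    ⟨(0, 0), by constructor <;> constructor <;> norm_num⟩ (isCompact_Icc.prod isCompact_Icc)
  have hmax' : ∀ t ∈ Icc (-3 / 4 : ℝ) 0, ∀ s ∈ Icc (-3 / 4 : ℝ) 0,
      w t + -w s - Ψ (t, s) ≤ w T + -w S - Ψ (T, S) := 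
    fun t ht s hs => hmax (show (t, s) ∈ _ from ⟨ht, hs⟩)
  by_contra! hcon
  obtain ⟨t, ht, s, hs, hts⟩ := hcon
  change Ψ (t, s) < w t - w s at hts
  have hin : (t, s) ∈ Icc (-3 / 4 : ℝ) 0 ×ˢ Icc (-3 / 4 : ℝ) 0 := by
    by_contra hc
    linarith [hout t ht s hs hc]
  have hpos : 0 < w T - w S - Ψ (T, S) := by linarith [hmax' t hin.1 s hin.2]
  have hall : ∀ t ∈ Ioc (-1 : ℝ) 0, ∀ s ∈ Ioc (-1 : ℝ) 0,
      w t - w s - Ψ (t, s) ≤ w T - w S - Ψ (T, S) := by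
    intro t ht s hs
    by_cases hc : (t, s) ∈ Icc (-3 / 4 : ℝ) 0 ×ˢ Icc (-3 / 4 : ℝ) 0
    · linarith [hmax' t hc.1 s hc.2]
    · linarith [hout t ht s hs hc]
  simp only [hΨ] at hpos hall
  rcases lt_trichotomy S T with hlt | heq | hgt
  · rw [abs_of_pos (sub_pos.2 hlt)] at hpos hall
    exact h₁.not_doubling_max h₂ H hα hα1 hM hMae ht₀ hS hT hlt hpos hall
  · rw [heq] at hpos
    have : 0 ≤ N * |T - T| ^ β + 32 * M * ((T - t₀) ^ 2 + (T - t₀) ^ 2) := by positivity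
    linarith
  · rw [abs_sub_comm T S, abs_of_pos (sub_pos.2 hgt)] at hpos hall
    -- When `T < S`, exchanging the two points amounts to replacing `w` by `-w`.
    refine h₂.not_doubling_max (w := fun t => -w t) (by simpa using h₁) H hα hα1
      (by simpa using hM) (by simpa using hMae) ht₀ hT hS hgt (by linarith) ?_
    intro s hs t ht
    have := hall t ht s hs
    rw [abs_sub_comm] at this
    linarith

theorem abs_sub_le (h₁ : IsExtremalSub lam Lam α F w)
    (h₂ : IsExtremalSub lam Lam α F fun t => -w t) (H : HolderConstants lam Lam γ κ β F M N)
    (hα : 2 * γ ≤ α) (hα1 : α < 1) (hM : ∀ t ∈ Ioc (-1 : ℝ) 0, |w t| ≤ M)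
    (hMae : ∀ᵐ t ∂volume.restrict (Iio 0), |w t| ≤ M) {t s : ℝ} (ht : t ∈ Icc (-1 / 2 : ℝ) 0)
    (hs : s ∈ Icc (-1 / 2 : ℝ) 0) : |w t - w s| ≤ (N + 32 * M) * |t - s| ^ β := by
  have key : ∀ t ∈ Icc (-1 / 2 : ℝ) 0, ∀ s ∈ Icc (-1 / 2 : ℝ) 0,
      w t - w s ≤ (N + 32 * M) * |t - s| ^ β := by
    intro t ht s hs
    -- Centring the penalty at `t₀ = t` leaves only `(s - t) ^ 2`, which is dominated by `|t - s| ^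
    -- β`.
    have h1 := h₁.sub_le_modulus h₂ H hα hα1 hM hMae ht t ⟨by linarith [ht.1], ht.2⟩ s
      ⟨by linarith [hs.1], hs.2⟩
    have hle : |t - s| ≤ 1 := abs_le.2 ⟨by linarith [ht.1, hs.2], by linarith [ht.2, hs.1]⟩
    have h2 : (s - t) ^ 2 ≤ |t - s| ^ β := by
      rw [← sq_abs, abs_sub_comm, ← Real.rpow_natCast]
      refine Real.rpow_le_rpow_of_exponent_ge' (abs_nonneg _) hle H.beta_pos.le ?_
      have := H.beta_le
      have := H.gamma_le
      push_cast
      linarith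
    have h3 := mul_le_mul_of_nonneg_left h2 (show 0 ≤ 32 * M by linarith [H.M_pos])
    rw [sub_self] at h1
    linarith
  refine abs_le.2 ⟨?_, key t ht s hs⟩
  have := key s hs t ht
  rw [abs_sub_comm] at this
  linarith

end IsExtremalSub

/-! ### Norms and conclusion -/

theorem eLpNorm_top_lt_top_of_forall_bound {u : ℝ → ℝ} {s : Set ℝ} (hs : MeasurableSet s) {B : ℝ}
    (hB : ∀ t ∈ s, |u t| ≤ B) : eLpNorm u ∞ (volume.restrict s) < ∞ := by
  rw [eLpNorm_exponent_top]
  refine eLpNormEssSup_lt_top_of_ae_bound (C := B) ?_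
  filter_upwards [ae_restrict_mem hs] with t ht
  exact hB t ht

theorem ae_abs_le_toReal_eLpNorm_top {u : ℝ → ℝ} {μ : Measure ℝ} (h : eLpNorm u ∞ μ < ∞) :
    ∀ᵐ t ∂μ, |u t| ≤ (eLpNorm u ∞ μ).toReal := by
  rw [eLpNorm_exponent_top] at h ⊢
  filter_upwards [ae_le_eLpNormEssSup (f := u) (μ := μ)] with t ht
  rw [← Real.norm_eq_abs, ← toReal_enorm]
  exact ENNReal.toReal_mono h.ne ht

theorem ContinuousOn.abs_le_of_ae_abs_le {f : ℝ → ℝ} {a b F : ℝ} (hab : a ≠ b)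
    (hf : ContinuousOn f (Icc a b)) (h : ∀ᵐ t ∂volume.restrict (Icc a b), |f t| ≤ F) :
    ∀ t ∈ Icc a b, |f t| ≤ F := by
  have he : (fun t => max |f t| F) =ᵐ[volume.restrict (Icc a b)] fun _ => F := by
    filter_upwards [h] with t ht
    exact max_eq_right ht
  intro t ht
  have := Measure.eqOn_Icc_of_ae_eq volume hab he (hf.abs.sup continuousOn_const)
    continuousOn_const ht
  exact max_eq_right_iff.1 this

theorem holderNormOn_le {u : ℝ → ℝ} {S : Set ℝ} {β : ℝ≥0} {M D : ℝ} (hM : 0 ≤ M) (hD : 0 ≤ D)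
    (h1 : ∀ t ∈ S, |u t| ≤ M) (h2 : ∀ t ∈ S, ∀ s ∈ S, |u t - u s| ≤ D * |t - s| ^ (β : ℝ)) :
    holderNormOn β u S ≤ ENNReal.ofReal (M + D) := by
  rw [ENNReal.ofReal_add hM hD]
  refine add_le_add (iSup₂_le fun t ht => ?_) ?_
  · rw [Real.enorm_eq_ofReal_abs]
    exact ENNReal.ofReal_le_ofReal (h1 t ht)
  · refine HolderWith.eHolderNorm_le (C := D.toNNReal) ?_
    rintro ⟨t, ht⟩ ⟨s, hs⟩
    change edist (u t) (u s) ≤ ENNReal.ofReal D * edist t s ^ (β : ℝ)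
    rw [edist_dist, edist_dist, Real.dist_eq, Real.dist_eq,
      ENNReal.ofReal_rpow_of_nonneg (abs_nonneg _) β.coe_nonneg, ← ENNReal.ofReal_mul hD]
    exact ENNReal.ofReal_le_ofReal (h2 t ht s hs)

/-- The order of choice matters: `γ = α₀ / 2`, then `κ`, then `β`, then `P`, none depending on `α`,
`F` or `M`. Each of the three summands of `P` secures one of the lower bounds on `N`, the first two
with a spare factor `2` for strictness. -/
theorem exists_holderConstants {lam Lam α₀ : ℝ} (hlam : 0 < lam) (hLam : lam ≤ Lam) (hα₀ : 0 < α₀)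
    (hα₀1 : α₀ < 1) : ∃ κ β P : ℝ, 0 < β ∧ β ≤ 1 ∧ 0 < P ∧ ∀ F M : ℝ, 0 ≤ F → 0 < M →
      HolderConstants lam Lam (α₀ / 2) κ β F M (P * (M + F)) := by
  obtain ⟨γ, hγ⟩ : ∃ γ, γ = α₀ / 2 := ⟨_, rfl⟩
  rw [← hγ]
  have hγ0 : 0 < γ := by linarith
  have hL : 0 < Lam := hlam.trans_le hLam
  obtain ⟨κ, hκ⟩ : ∃ κ, κ = lam * γ ^ 2 / (2 * Lam) := ⟨_, rfl⟩
  have hκ0 : 0 < κ := by rw [hκ]; positivity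
  obtain ⟨β, hβ⟩ : ∃ β, β = lam / (72 * Lam * (1 / κ + 1 / γ ^ 2)) := ⟨_, rfl⟩
  have hβ0 : 0 < β := by rw [hβ]; positivity
  have hβs : Lam * β * (1 / κ + 1 / γ ^ 2) = lam / 72 := by
    rw [hβ]
    have : 1 / κ + 1 / γ ^ 2 ≠ 0 := by positivity
    field_simp
  have hβγ : β ≤ γ := by
    have h1 : Lam * β * (1 / γ ^ 2) ≤ lam / 72 := by
      rw [← hβs]
      gcongr
      linarith [one_div_pos.2 hκ0]
    rw [mul_one_div, div_le_iff₀ (by positivity)] at h1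
    have h2 : Lam * β ≤ Lam * γ := by
      calc Lam * β ≤ lam / 72 * γ ^ 2 := h1
        _ ≤ Lam * γ := by
          rw [sq, ← mul_assoc]
          gcongr
          nlinarith
    exact le_of_mul_le_mul_left h2 hL
  obtain ⟨C, hC⟩ : ∃ C, C = (72 * Lam + 1) / (2 * γ) := ⟨_, rfl⟩
  have hC0 : 0 < C := by rw [hC]; positivity
  refine ⟨κ, β, 4 * C / (lam * β) + 144 * C / (lam * κ) + 24, hβ0, by linarith, by positivity,
    fun F M hF hM => ?_⟩
  have hMF : 0 < M + F := by linarith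
  have a1 : 0 < 4 * C / (lam * β) := by positivity
  have a2 : 0 < 144 * C / (lam * κ) := by positivity
  refine ⟨hlam, hLam, hκ0, hβ0, hβγ, by linarith, hF, hM, ?_, hβs.le, ?_, ?_, ?_⟩
  · rw [hκ]; field_simp; rfl
  · rw [← hC]
    calc C * (M + F) < 4 * C / (lam * β) * (M + F) * lam * β / 2 := by
          have : 4 * C / (lam * β) * (M + F) * lam * β / 2 = 2 * (C * (M + F)) := by
            field_simp; ring
          rw [this]
          linarith [mul_pos hC0 hMF]
      _ ≤ _ := by gcongr; linarith
  · rw [← hC]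
    calc C * (M + F) / κ < 144 * C / (lam * κ) * (M + F) * lam / 72 := by
          have : 144 * C / (lam * κ) * (M + F) * lam / 72 = 2 * (C * (M + F) / κ) := by
            field_simp; ring
          rw [this]
          linarith [div_pos (mul_pos hC0 hMF) hκ0]
      _ ≤ _ := by gcongr; linarith
  · calc 24 * M ≤ 24 * (M + F) := by linarith
      _ ≤ _ := by gcongr; linarith

theorem theorem1p1 (lam Lam α₀ : ℝ) (hlam : 0 < lam) (hLam : lam ≤ Lam) (hα₀ : 0 < α₀) :
    ∃ (β : ℝ≥0) (C : ℝ), 0 < β ∧ β ≤ 1 ∧ 0 < C ∧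
      ∀ (α : ℝ), α₀ ≤ α → α < 1 →
      ∀ (ι κ : Type*) [Nonempty ι] [Nonempty κ] (K : ι → κ → ℝ → ℝ → ℝ),
      (∀ k l, IsMarchaudKernel lam Lam α (K k l)) →
      ∀ f u : ℝ → ℝ,
      ContinuousOn f (Icc (-1) 0) →
      AEMeasurable u (volume.restrict (Iic 0)) →
      (∃ B : ℝ, ∀ t ≤ 0, |u t| ≤ B) →
      IsViscositySolution (supInfMarchaud K) f u (Ioc (-1) 0) →
      holderNormOn β u (Icc (-1 / 2) 0) ≤
        ENNReal.ofReal C * (eLpNorm u ∞ (volume.restrict (Iio (-1))) +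
          eLpNorm f ∞ (volume.restrict (Icc (-1) 0))) := by

  -- For `1 ≤ α₀` no `α` is admissible.
  rcases le_or_gt 1 α₀ with hα₀1 | hα₀1
  · exact ⟨1, 1, one_pos, le_rfl, one_pos, fun α h1 h2 => absurd (hα₀1.trans h1) (not_le.2 h2)⟩
  obtain ⟨κ, β, P, hβ0, hβ1, hP, hH⟩ := exists_holderConstants hlam hLam hα₀ hα₀1
  have hC : 0 < (33 + P) * (1 + 2 / lam) := by positivity
  refine ⟨⟨β, hβ0.le⟩, (33 + P) * (1 + 2 / lam), hβ0, hβ1, hC, ?_⟩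
  intro α hα hα1 ι ι' _ _ K hK f u hf hu ⟨B, hB⟩ hsol
  have hα0 : 0 < α := hα₀.trans_le hα
  have hufin : eLpNorm u ∞ (volume.restrict (Iio (-1))) < ∞ :=
    eLpNorm_top_lt_top_of_forall_bound measurableSet_Iio fun t ht => hB t (by
      have : t < -1 := ht
      linarith)
  obtain ⟨Bf, hBf⟩ := isCompact_Icc.exists_bound_of_continuousOn hf
  have hffin : eLpNorm f ∞ (volume.restrict (Icc (-1) 0)) < ∞ :=
    eLpNorm_top_lt_top_of_forall_bound measurableSet_Icc hBf
  have huae := ae_abs_le_toReal_eLpNorm_top hufin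
  have hfle := hf.abs_le_of_ae_abs_le (by norm_num) (ae_abs_le_toReal_eLpNorm_top hffin)
  rw [← ENNReal.ofReal_toReal hufin.ne, ← ENNReal.ofReal_toReal hffin.ne]
  obtain ⟨X, hX⟩ : ∃ X, X = (eLpNorm u ∞ (volume.restrict (Iio (-1)))).toReal := ⟨_, rfl⟩
  obtain ⟨F, hF⟩ : ∃ F, F = (eLpNorm f ∞ (volume.restrict (Icc (-1) 0))).toReal := ⟨_, rfl⟩
  have hX0 : 0 ≤ X := hX ▸ ENNReal.toReal_nonneg
  have hF0 : 0 ≤ F := hF ▸ ENNReal.toReal_nonneg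
  rw [← hX] at huae ⊢
  rw [← hF] at hfle ⊢
  have h₁ : IsExtremalSub lam Lam α F u := hsol.1.isExtremalSub hlam hα0 hα1 hK hu hB hF0
    fun t ht => (abs_le.1 (hfle t ⟨ht.1.le, ht.2⟩)).2
  have h₂ : IsExtremalSub lam Lam α F fun t => -u t :=
    hsol.2.isExtremalSub_neg hlam hα0 hα1 hK hu hB hF0
      fun t ht => (abs_le.1 (hfle t ⟨ht.1.le, ht.2⟩)).1
  have hmax : ∀ t ∈ Ioc (-1 : ℝ) 0, |u t| ≤ X + 2 * F / lam := by
    intro t ht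
    have b1 := h₁.le_of_ae_le hlam hLam hα0 hα1 hF0
      (fun s hs => (abs_le.1 (hB s hs.2)).2) (huae.mono fun s hs => (abs_le.1 hs).2) ht
    have b2 := h₂.le_of_ae_le hlam hLam hα0 hα1 hF0 (B := B)
      (fun s hs => by linarith [(abs_le.1 (hB s hs.2)).1])
      (huae.mono fun s hs => by linarith [(abs_le.1 hs).1] : ∀ᵐ s ∂_, -u s ≤ X) ht
    exact abs_le.2 ⟨by linarith, b1⟩
  rw [← ENNReal.ofReal_add hX0 hF0, ← ENNReal.ofReal_mul hC.le]
  -- The doubling argument needs `M > 0`, whereas the data may vanish; `δ` provides the slack and is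
  -- then sent to zero.
  refine ENNReal.le_of_forall_pos_le_add fun δ hδ _ => ?_
  have hδ' : (0 : ℝ) < δ := hδ
  obtain ⟨M, hM⟩ : ∃ M, M = X + 2 * F / lam + δ / (33 + P) := ⟨_, rfl⟩
  have hMpos : 0 < δ / (33 + P) := by positivity
  have h2F : 0 ≤ 2 * F / lam := by positivity
  have hM0 : 0 < M := by linarith
  have hMle : ∀ t ∈ Ioc (-1 : ℝ) 0, |u t| ≤ M := fun t ht => by linarith [hmax t ht]
  have hMae : ∀ᵐ t ∂volume.restrict (Iio 0), |u t| ≤ M := by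
    rw [ae_restrict_iff' measurableSet_Iio] at huae ⊢
    filter_upwards [huae, Measure.ae_ne volume (-1 : ℝ)] with t ht hne ht0
    rcases lt_or_gt_of_ne hne with hlt | hgt
    · linarith [ht hlt]
    · exact hMle t ⟨hgt, le_of_lt ht0⟩
  have hHol := holderNormOn_le (u := u) (S := Icc (-1 / 2) 0) (β := ⟨β, hβ0.le⟩) (M := M)
    (D := P * (M + F) + 32 * M) hM0.le (by positivity)
    (fun t ht => hMle t ⟨by linarith [ht.1], ht.2⟩)
    (fun t ht s hs => h₁.abs_sub_le h₂ (hH F M hF0 hM0) (by linarith) hα1 hMle hMae ht hs)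
  refine hHol.trans ?_
  rw [← ENNReal.ofReal_coe_nnreal, ← ENNReal.ofReal_add (by positivity) hδ'.le]
  refine ENNReal.ofReal_le_ofReal ?_
  have e1 : (33 + P) * M = (33 + P) * (X + 2 * F / lam) + δ := by
    rw [hM]; field_simp
  have e2 : (33 + P) * (1 + 2 / lam) * (X + F) =
      (33 + P) * (X + 2 * F / lam) + (33 + P) * (F + 2 / lam * X) := by ring
  have e3 : 0 ≤ P * (2 / lam * X) + 33 * (F + 2 / lam * X) := by positivity
  nlinarith
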